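/- Let $\alpha>1$ and let $V(x)=\frac{1}{1+\alpha}|x|^{1+\alpha}H(-x)$ be the Hertz potential, where $H$ is the Heaviside function ($H=0$ on $(-\infty,0)$, $H=1$ on $(0,\infty)$). Consider the infinite chain $$\frac{d^2x_n}{dt^2}=V'(x_{n+1}-x_n)-V'(x_n-x_{n-1}),\qquad n\in\mathbb Z. \tag{1}$$ Let $C^k_{\rm per}(0,2\pi)$ denote the space of $2\pi$-periodic $C^k$ functions $\mathbb R\to\mathbb R$ with the supremum norm over all derivatives up to order $k$. Put $W(x)=\frac{2^\alpha}{1+\alpha}|x|^{1+\alpha}$ and $$p_0=(1+\alpha)^{\frac{\alpha}{1-\alpha}}\left[\frac{\sqrt\pi\,\Gamma\!\left(\frac1{1+\alpha}+\frac12\right)}{\Gamma\!\left(\frac1{1+\alpha}\right)}\right]^{\frac{1+\alpha}{1-\alpha}}.$$ Then there exist an open interval $\mathcal V=(-\delta,\delta)$, $\delta>0$, and functions $u_\mu\in C^2_{\rm per}(0,2\pi)$, $\mu\in\mathcal V$, such that: 1. For all $a>0$ and $\mu\in\mathcal V$, and for either choice of the sign, $x_n^\pm(t;a,\mu)=a\,u_\mu\big[(\pi+\mu)n\pm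 a^{\frac{\alpha-1}{2}}t\big]$ is a solution of (1). 2. For all $\mu\in\mathcal V$, the $2\pi$-periodic function $u_\mu$ is odd and satisfies $$u_\mu''(\xi)=V'(u_\mu(\xi+\pi+\mu)-u_\mu(\xi))-V'(u_\mu(\xi)-u_\mu(\xi-\pi-\mu)),\qquad \xi\in\mathbb R.$$ 3. The map $\mu\mapsto u_\mu$ belongs to $C^1(\mathcal V,C^2_{\rm per}(0,2\pi))$ and $u_\mu(\xi)=-u_{-\mu}(\xi+\pi)$ for all $\mu\in\mathcal V$, $\xi\in\mathbb R$. 4. $u_0$ is the unique $C^2$ solution on $\mathbb R$ of $u''+W'(u)=0$, $u(0)=0$, $u'(0)=p_0$. 5. For each $\mu\in(-\delta,0)$ there are $\xi_1(\mu)>0$ and $p_\mu\in\mathbb R$ such that $u_\mu(\xi)=p_\mu\,\xi$ for all $\xi\in[-\xi_1(\mu),\xi_1(\mu)]$, and, as $\mu\to0^-$, $\xi_1(\mu)=|\mu|/2+o(\mu)$ and $p_\mu=p_0+O(|\mu|)$. Moreover, for all $a>0$, all $n,k\in\mathbb Z$ and all $t\in\mathbb R$ with $(\pi+\mu)n\pm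 a^{\frac{\alpha-1}{2}}t\in(-\xi_1(\mu)+2k\pi,\ \xi_1(\mu)+2k\pi)$, the $n$th particle is in free flight: $$x_{n+1}^\pm(t;a,\mu)>x_n^\pm(t;a,\mu),\qquad x_n^\pm(t;a,\mu)>x_{n-1}^\pm(t;a,\mu),\qquad \dot x_n^\pm(t;a,\mu)=\pm a^{\frac{\alpha+1}{2}}p_\mu,$$ with the same sign $\pm$ throughout. -/

import Mathlib

open Set Filter Topology Asymptotics

noncomputable section

namespace HertzChain

/-! Hertzian potentials and the lattice -/

/-- The Heaviside function (its value at `0` plays no role below, where it multiplies a factor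
vanishing at `0`). -/
def heaviside (x : ℝ) : ℝ := if 0 ≤ x then 1 else 0

/-- The Hertz interaction potential `V(x) = |x|^{1+α} H(-x) / (1+α)`. -/
def V (α : ℝ) (x : ℝ) : ℝ := 1 / (1 + α) * |x| ^ (1 + α) * heaviside (-x)

/-- The symmetrized Hertz potential `W(x) = 2^α |x|^{1+α} / (1+α)`. -/
def W (α : ℝ) (x : ℝ) : ℝ := (2 : ℝ) ^ α / (1 + α) * |x| ^ (1 + α)

/-- `x n t` is the displacement at time `t` of the `n`-th bead: (classical, global in time)
solutions of `x_n'' = V'(x_{n+1} - x_n) - V'(x_n - x_{n-1})`, `n ∈ ℤ`. -/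
def IsChainSolution (α : ℝ) (x : ℤ → ℝ → ℝ) : Prop :=
  ∀ n : ℤ, ContDiff ℝ 2 (x n) ∧
    ∀ t : ℝ, iteratedDeriv 2 (x n) t =
      deriv (V α) (x (n + 1) t - x n t) - deriv (V α) (x n t - x (n - 1) t)

/-- The advance-delay equation `u''(ξ) = V'(u(ξ+q) - u(ξ)) - V'(u(ξ) - u(ξ-q))` for `C²`
functions, with wavenumber `q`. -/
def IsAdvanceDelaySolution (α q : ℝ) (u : ℝ → ℝ) : Prop :=
  ContDiff ℝ 2 u ∧ ∀ ξ : ℝ, iteratedDeriv 2 u ξ =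
    deriv (V α) (u (ξ + q) - u ξ) - deriv (V α) (u ξ - u (ξ - q))

/-- The initial slope `p₀` of the binary oscillation. -/
def p₀ (α : ℝ) : ℝ :=
  (1 + α) ^ (α / (1 - α)) *
    (√Real.pi * Real.Gamma (1 / (1 + α) + 1 / 2) / Real.Gamma (1 / (1 + α))) ^
      ((1 + α) / (1 - α))

/-- `v` is a solution on `ℝ` of the initial value problem
`v'' + W'(v) = 0`, `v(0) = 0`, `v'(0) = p₀`. -/
def IsBinaryOscillation (α : ℝ) (v : ℝ → ℝ) : Prop :=
  ContDiff ℝ 2 v ∧ (∀ ξ : ℝ, iteratedDeriv 2 v ξ + deriv (W α) (v ξ) = 0) ∧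
    v 0 = 0 ∧ deriv v 0 = p₀ α

/-- The phase `ξ = (π + μ) n + s a^{(α-1)/2} t`, with sign `s = ±1`. -/
def wavePhase (α s a μ : ℝ) (n : ℤ) (t : ℝ) : ℝ :=
  (Real.pi + μ) * n + s * a ^ ((α - 1) / 2) * t

/-- The travelling wave with profile `u`, amplitude parameter `a`, wavenumber `π + μ`, and sign
`s = ±1`: `x_n(t) = a u((π + μ) n + s a^{(α-1)/2} t)`. -/
def travellingWave (α s a μ : ℝ) (u : ℝ → ℝ) (n : ℤ) (t : ℝ) : ℝ :=
  a * u (wavePhase α s a μ n t)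

/-! The space of `2π`-periodic functions of class `C^k` -/

/-- The vector space of `2π`-periodic functions `ℝ → ℝ` of class `C^k`. -/
def cPerSubmodule (k : ℕ) : Submodule ℝ (ℝ → ℝ) where
  carrier := {u | ContDiff ℝ k u ∧ Function.Periodic u (2 * Real.pi)}
  add_mem' := fun hu hv => ⟨hu.1.add hv.1, hu.2.add hv.2⟩
  zero_mem' := ⟨contDiff_const, fun _ => rfl⟩
  smul_mem' := fun c _ hu => ⟨hu.1.const_smul c, fun x => by simp [hu.2 x]⟩

/-- `C^k_per(0, 2π)`. This is a type of its own, so that it does not inherit the topology of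
pointwise convergence from `ℝ → ℝ`; its norm is defined below. -/
def CPer (k : ℕ) : Type := ↥(cPerSubmodule k)

namespace CPer

variable {k : ℕ}

instance : AddCommGroup (CPer k) := inferInstanceAs (AddCommGroup ↥(cPerSubmodule k))

instance : Module ℝ (CPer k) := inferInstanceAs (Module ℝ ↥(cPerSubmodule k))

instance : CoeFun (CPer k) (fun _ => ℝ → ℝ) := ⟨fun u => u.1⟩

theorem contDiff (u : CPer k) : ContDiff ℝ k u := u.2.1

theorem periodic (u : CPer k) : Function.Periodic u (2 * Real.pi) := u.2.2

theorem continuous_iteratedDeriv (u : CPer k) (i : Fin (k + 1)) :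
    Continuous (iteratedDeriv (i : ℕ) u) :=
  u.contDiff.continuous_iteratedDeriv (i : ℕ) (by exact_mod_cast Nat.lt_succ_iff.mp i.2)

theorem periodic_iteratedDeriv (u : CPer k) (i : ℕ) :
    Function.Periodic (iteratedDeriv i u) (2 * Real.pi) := by
  intro x
  have h : (fun z => (u : ℝ → ℝ) (z + 2 * Real.pi)) = u := funext u.periodic
  have h2 := congrFun (iteratedDeriv_comp_add_const i (u : ℝ → ℝ) (2 * Real.pi)) x
  rw [h] at h2
  exact h2.symm

/-- The `i`-th derivative (`i ≤ k`) of `u ∈ C^k_per`, as a bounded continuous function. -/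
def bddDeriv (u : CPer k) (i : Fin (k + 1)) : BoundedContinuousFunction ℝ ℝ where
  toFun := iteratedDeriv (i : ℕ) u
  continuous_toFun := u.continuous_iteratedDeriv i
  map_bounded' := by
    have hb := (u.periodic_iteratedDeriv i).isBounded_of_continuous
      (by positivity) (u.continuous_iteratedDeriv i)
    obtain ⟨C, hC⟩ := Metric.isBounded_iff.mp hb
    exact ⟨C, fun x y => hC (mem_range_self x) (mem_range_self y)⟩

/-- The linear map `u ↦ (u, u', …, u^{(k)})`. -/
def jet (k : ℕ) : CPer k →ₗ[ℝ] (Fin (k + 1) → BoundedContinuousFunction ℝ ℝ) where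
  toFun := bddDeriv
  map_add' := fun u v => by
    ext i x
    have hi : ((i : ℕ) : WithTop ℕ∞) ≤ (k : WithTop ℕ∞) := by
      exact_mod_cast Nat.lt_succ_iff.mp i.2
    exact iteratedDeriv_add ((u.contDiff.of_le hi).contDiffAt) ((v.contDiff.of_le hi).contDiffAt)
  map_smul' := fun c u => by
    ext i x
    have hi : ((i : ℕ) : WithTop ℕ∞) ≤ (k : WithTop ℕ∞) := by
      exact_mod_cast Nat.lt_succ_iff.mp i.2
    exact iteratedDeriv_const_smul ((u.contDiff.of_le hi).contDiffAt) c

theorem jet_injective (k : ℕ) : Function.Injective (jet k) := by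
  intro u v h
  apply Subtype.ext
  funext x
  have h0 := DFunLike.congr_fun (congrFun h 0) x
  change iteratedDeriv 0 (u : ℝ → ℝ) x = iteratedDeriv 0 (v : ℝ → ℝ) x at h0
  simpa using h0

/-- The norm of `C^k_per`: `‖u‖ = max_{0 ≤ i ≤ k} sup_ξ |u^{(i)}(ξ)|`. -/
instance : NormedAddCommGroup (CPer k) :=
  NormedAddCommGroup.induced (CPer k) (Fin (k + 1) → BoundedContinuousFunction ℝ ℝ)
    (jet k) (jet_injective k)

instance : NormedSpace ℝ (CPer k) :=
  NormedSpace.induced ℝ (CPer k) (Fin (k + 1) → BoundedContinuousFunction ℝ ℝ) (jet k)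

end CPer

end HertzChain

end

/-! The unknown is the acceleration `f`, a continuous function on the circle, and the profile is
`sol f`, the odd `2π`-periodic function whose second derivative is the odd part of `f`. The
advance-delay equation becomes `residual hα (μ, f) = 0`, solved near `μ = 0` by the implicit
function theorem. The two integrations in `sol` supply the regularity in `μ`: translations alone are
not differentiable on `C(Circ, ℝ)`, but translation after `solL` is `C¹` in operator norm
(`contDiff_shift_comp_solL`), while `α > 1` makes the truncated power, hence its superposition
operator, `C¹`.

At `μ = 0` the two neighbours of a bead move alike, and an odd `π`-antiperiodic profile need only
solve `v'' + W'(v) = 0`. Conservation of energy integrates this explicitly through a phase whose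
period is a Beta integral; `p₀` is the initial slope for which the period is `2π`
(`exists_isBinaryProfile`).

The linearization there reduces to a Hill equation for the antiperiodic part of the perturbation. It
has an even solution `u'` from translation and an odd one, `scalingMode`, from the homogeneity of
the force. An odd antiperiodic function has zero derivative at `π/2`, and `scalingMode` does not
because the period depends on the amplitude. So the kernel is trivial, and variation of constants
gives surjectivity.

Replacing `u` by `-u(· + π)` and `μ` by `-μ` preserves the equation, so local uniqueness gives the
symmetry of the branch. For `μ < 0` it yields `u_μ(ξ + π + μ) - u_μ(ξ) = -u_{-μ}(ξ + μ) - u_μ(ξ)`,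
which is `-p₀ (2ξ + μ)` up to `O(μ²)` for `ξ = O(|μ|)`. This is positive until `ξ` is close to
`|μ|/2`; by oddness both contacts are then open for `|ξ| ≤ ξ₁`, no force acts, and the profile is
linear (`gap_of_branch`). -/

noncomputable section

namespace HertzChain

/-! ### Truncated powers -/

/-- The truncated power `x ↦ (max x 0) ^ p`. -/
def posPow (p x : ℝ) : ℝ := (max x 0) ^ p

theorem posPow_of_nonneg {p x : ℝ} (hx : 0 ≤ x) : posPow p x = x ^ p := by
  rw [posPow, max_eq_left hx]

theorem posPow_of_nonpos {p x : ℝ} (hp : p ≠ 0) (hx : x ≤ 0) : posPow p x = 0 := by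
  rw [posPow, max_eq_right hx, Real.zero_rpow hp]

theorem continuous_posPow {p : ℝ} (hp : 0 ≤ p) : Continuous (posPow p) :=
  (continuous_id.max continuous_const).rpow_const fun _ => Or.inr hp

theorem posPow_mul {p a : ℝ} (ha : 0 ≤ a) (x : ℝ) : posPow p (a * x) = a ^ p * posPow p x := by
  rw [posPow, posPow, ← Real.mul_rpow ha (le_max_right _ _), mul_max_of_nonneg _ _ ha, mul_zero]

/-- At the kink `0` the derivative is recovered as the limit of the derivatives at nearby points,
which exists because `p - 1 > 0`. -/
theorem hasDerivAt_posPow {p : ℝ} (hp : 1 < p) (x : ℝ) :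
    HasDerivAt (posPow p) (p * posPow (p - 1) x) x := by
  rcases lt_trichotomy x 0 with hx | rfl | hx
  · rw [posPow_of_nonpos (by linarith) hx.le, mul_zero]
    refine (hasDerivAt_const x (0 : ℝ)).congr_of_eventuallyEq ?_
    filter_upwards [Iio_mem_nhds hx] with y hy
    exact posPow_of_nonpos (by linarith) (le_of_lt hy)
  · have h : ∀ y ≠ (0 : ℝ), HasDerivAt (posPow p) (p * posPow (p - 1) y) y := by
      intro y hy
      rcases lt_or_gt_of_ne hy with hy | hy
      · rw [posPow_of_nonpos (by linarith) hy.le, mul_zero]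
        refine (hasDerivAt_const y (0 : ℝ)).congr_of_eventuallyEq ?_
        filter_upwards [Iio_mem_nhds hy] with z hz
        exact posPow_of_nonpos (by linarith) (le_of_lt hz)
      · rw [posPow_of_nonneg hy.le]
        refine (Real.hasDerivAt_rpow_const (Or.inl hy.ne')).congr_of_eventuallyEq ?_
        filter_upwards [Ioi_mem_nhds hy] with z hz
        exact posPow_of_nonneg (le_of_lt hz)
    exact hasDerivAt_of_hasDerivAt_of_ne (g := fun y => p * posPow (p - 1) y) h
      (continuous_posPow (by linarith)).continuousAt
      ((continuous_posPow (by linarith)).const_mul p).continuousAt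
  · rw [posPow_of_nonneg hx.le]
    refine (Real.hasDerivAt_rpow_const (Or.inl hx.ne')).congr_of_eventuallyEq ?_
    filter_upwards [Ioi_mem_nhds hx] with z hz
    exact posPow_of_nonneg (le_of_lt hz)

theorem posPow_add_posPow_neg {p : ℝ} (hp : p ≠ 0) (x : ℝ) :
    posPow p x + posPow p (-x) = |x| ^ p := by
  rcases le_total 0 x with hx | hx
  · rw [posPow_of_nonneg hx, posPow_of_nonpos hp (by linarith), abs_of_nonneg hx, add_zero]
  · rw [posPow_of_nonpos hp hx, posPow_of_nonneg (by linarith), abs_of_nonpos hx, zero_add]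

theorem V_eq_posPow {α : ℝ} (hα : 1 < α) (x : ℝ) : V α x = 1 / (1 + α) * posPow (1 + α) (-x) := by
  rw [V, heaviside]
  split_ifs with h
  · rw [posPow_of_nonneg h, abs_of_nonpos (by linarith), mul_one]
  · rw [posPow_of_nonpos (by linarith) (le_of_not_ge h)]; simp

theorem deriv_V {α : ℝ} (hα : 1 < α) (x : ℝ) : deriv (V α) x = -posPow α (-x) := by
  have h : HasDerivAt (fun y => 1 / (1 + α) * posPow (1 + α) (-y)) (-posPow α (-x)) x := by
    have := ((hasDerivAt_posPow (p := 1 + α) (by linarith) (-x)).comp x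
      (hasDerivAt_neg x)).const_mul (1 / (1 + α))
    refine this.congr_deriv ?_
    have : (1 + α) ≠ 0 := by linarith
    rw [add_sub_cancel_left]
    field_simp
  rw [← h.deriv]
  congr 1
  exact funext fun y => V_eq_posPow hα y

/-- The restoring force `W'` of the symmetrized potential. -/
def force (α x : ℝ) : ℝ := 2 ^ α * (posPow α x - posPow α (-x))

/-- The derivative `W''` of the force. -/
def stiffness (α x : ℝ) : ℝ := 2 ^ α * α * |x| ^ (α - 1)

theorem deriv_W {α : ℝ} (hα : 1 < α) (x : ℝ) : deriv (W α) x = force α x := by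
  have h : HasDerivAt (fun y => (2 : ℝ) ^ α / (1 + α) * (posPow (1 + α) y + posPow (1 + α) (-y)))
      (force α x) x := by
    have h1 := hasDerivAt_posPow (p := 1 + α) (by linarith) x
    have h2 := (hasDerivAt_posPow (p := 1 + α) (by linarith) (-x)).comp x (hasDerivAt_neg x)
    refine ((h1.add h2).const_mul _).congr_deriv ?_
    have : (1 + α) ≠ 0 := by linarith
    rw [add_sub_cancel_left, force]
    field_simp
    ring
  rw [← h.deriv]
  congr 1
  funext y
  rw [W, posPow_add_posPow_neg (by linarith)]

theorem hasDerivAt_force {α : ℝ} (hα : 1 < α) (x : ℝ) :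
    HasDerivAt (force α) (stiffness α x) x := by
  have h1 := hasDerivAt_posPow hα x
  have h2 := (hasDerivAt_posPow hα (-x)).comp x (hasDerivAt_neg x)
  refine ((h1.sub h2).const_mul (2 ^ α)).congr_deriv ?_
  rw [stiffness, ← posPow_add_posPow_neg (by linarith)]
  ring

theorem continuous_stiffness {α : ℝ} (hα : 1 < α) : Continuous (stiffness α) :=
  (continuous_abs.rpow_const fun _ => Or.inr (by linarith)).const_mul _

/-- Euler's identity for a force homogeneous of degree `α`; it is what makes `scalingMode` solve the
linearized equation. -/
theorem stiffness_mul_self {α : ℝ} (hα : 1 < α) (x : ℝ) : stiffness α x * x = α * force α x := by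
  rw [stiffness, force]
  have key : ∀ y : ℝ, 0 ≤ y → y ^ (α - 1) * y = y ^ α := fun y hy => by
    rcases hy.eq_or_lt with rfl | hy
    · rw [mul_zero, Real.zero_rpow (by linarith)]
    · nth_rw 2 [← Real.rpow_one y]
      rw [← Real.rpow_add hy, sub_add_cancel]
  rcases le_total 0 x with hx | hx
  · rw [posPow_of_nonneg hx, posPow_of_nonpos (by linarith) (by linarith), abs_of_nonneg hx,
      mul_assoc, key x hx]
    ring
  · rw [posPow_of_nonpos (by linarith) hx, posPow_of_nonneg (by linarith), abs_of_nonpos hx]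
    have := key (-x) (by linarith)
    linear_combination (-(2 ^ α * α)) * this

theorem force_neg (α x : ℝ) : force α (-x) = -force α x := by
  rw [force, force, neg_neg]; ring

/-! ### Superposition operators on spaces of continuous functions -/

section Superposition

variable {T : Type*} [TopologicalSpace T] [CompactSpace T]

/-- The superposition operator `w ↦ φ ∘ w` on `C(T, ℝ)` is continuously differentiable if `φ` is. -/
theorem hasFDerivAt_superposition {φ φ' : C(ℝ, ℝ)} (h : ∀ x, HasDerivAt φ (φ' x) x) (w : C(T, ℝ)) :
    HasFDerivAt (fun v : C(T, ℝ) => φ.comp v)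
      (ContinuousLinearMap.mul ℝ C(T, ℝ) (φ'.comp w)) w := by
  rw [hasFDerivAt_iff_isLittleO_nhds_zero, isLittleO_iff]
  intro ε hε
  have hK : IsCompact (Icc (-(‖w‖ + 1)) (‖w‖ + 1)) := isCompact_Icc
  have huc := hK.uniformContinuousOn_of_continuous φ'.continuous.continuousOn
  obtain ⟨δ, hδ, hu⟩ := Metric.uniformContinuousOn_iff.mp huc ε hε
  filter_upwards [Metric.ball_mem_nhds (0 : C(T, ℝ)) (lt_min hδ one_pos)] with v hv
  rw [mem_ball_zero_iff, lt_min_iff] at hv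
  rw [ContinuousMap.norm_le _ (by positivity)]
  intro t
  have hw := w.norm_coe_le_norm t
  have hvt := v.norm_coe_le_norm t
  rw [Real.norm_eq_abs] at hw hvt
  have hseg : ∀ s ∈ segment ℝ (w t) (w t + v t), |s - w t| ≤ ‖v‖ := by
    intro s hs
    have := norm_sub_le_of_mem_segment hs
    rw [Real.norm_eq_abs, Real.norm_eq_abs, add_sub_cancel_left] at this
    exact this.trans hvt
  -- Mean value inequality for `φ` minus its linear part at `w t`: uniform continuity of `φ'` on a
  -- compact interval makes the remainder at most `ε * ‖v‖`, uniformly in `t`.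
  have hmv := (convex_segment (w t) (w t + v t)).norm_image_sub_le_of_norm_hasDerivWithin_le
    (f := fun s => φ s - φ' (w t) * s) (f' := fun s => φ' s - φ' (w t)) (C := ε)
    (x := w t) (y := w t + v t) (fun s _ => by
      have := (h s).sub ((hasDerivAt_id s).const_mul (φ' (w t)))
      rw [mul_one] at this
      exact this.hasDerivWithinAt) (fun s hs => by
      have h1 := hseg s hs
      have h2 := abs_le.mp h1
      have h3 := abs_le.mp hw
      refine (hu s ⟨by linarith, by linarith⟩ (w t) ⟨by linarith, by linarith⟩ ?_).le
      rw [Real.dist_eq]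
      exact h1.trans_lt hv.1)
    (left_mem_segment ℝ _ _) (right_mem_segment ℝ _ _)
  have e : (φ.comp (w + v) - φ.comp w - ContinuousLinearMap.mul ℝ C(T, ℝ) (φ'.comp w) v) t
      = φ (w t + v t) - φ' (w t) * (w t + v t) - (φ (w t) - φ' (w t) * w t) := by
    simp; ring
  rw [e]
  refine hmv.trans ?_
  rw [add_sub_cancel_left, Real.norm_eq_abs]
  gcongr

theorem contDiff_superposition {φ φ' : C(ℝ, ℝ)} (h : ∀ x, HasDerivAt φ (φ' x) x) :
    ContDiff ℝ 1 (fun v : C(T, ℝ) => φ.comp v) := by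
  rw [contDiff_one_iff_hasFDerivAt]
  exact ⟨_, (ContinuousLinearMap.mul ℝ C(T, ℝ)).continuous.comp (ContinuousMap.continuous_postcomp φ'),
    fun w => hasFDerivAt_superposition h w⟩

end Superposition

/-! ### Elementary facts on primitives -/

theorem abs_sub_le_of_hasDerivAt {g g' : ℝ → ℝ} {M : ℝ} (h : ∀ x, HasDerivAt g (g' x) x)
    (hM : ∀ x, |g' x| ≤ M) (x y : ℝ) : |g y - g x| ≤ M * |y - x| := by
  simpa using convex_univ.norm_image_sub_le_of_norm_hasDerivWithin_le (f := g) (f' := g')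
    (fun s _ => (h s).hasDerivWithinAt) (fun s _ => hM s) (mem_univ x) (mem_univ y)

theorem abs_taylor_two_le {g g' g'' : ℝ → ℝ} {M : ℝ} (h : ∀ x, HasDerivAt g (g' x) x)
    (h' : ∀ x, HasDerivAt g' (g'' x) x) (hM : ∀ x, |g'' x| ≤ M) (x k : ℝ) :
    |g (x + k) - g x - k * g' x| ≤ M * |k| * |k| := by
  have key := (convex_segment x (x + k)).norm_image_sub_le_of_norm_hasDerivWithin_le
    (f := fun s => g s - g' x * s) (f' := fun s => g' s - g' x) (C := M * |k|)
    (x := x) (y := x + k) (fun s _ => by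
      have := (h s).sub ((hasDerivAt_id s).const_mul (g' x))
      rw [mul_one] at this
      exact this.hasDerivWithinAt) (fun s hs => by
      have h1 := norm_sub_le_of_mem_segment hs
      rw [Real.norm_eq_abs, Real.norm_eq_abs, add_sub_cancel_left] at h1
      exact (abs_sub_le_of_hasDerivAt h' hM x s).trans
        (mul_le_mul_of_nonneg_left h1 ((abs_nonneg _).trans (hM x))))
    (left_mem_segment ℝ _ _) (right_mem_segment ℝ _ _)
  rw [add_sub_cancel_left, Real.norm_eq_abs, Real.norm_eq_abs] at key
  refine le_trans (le_of_eq ?_) key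
  congr 1; ring

theorem eq_of_hasDerivAt_of_eq {g h g' : ℝ → ℝ} (hg : ∀ x, HasDerivAt g (g' x) x)
    (hh : ∀ x, HasDerivAt h (g' x) x) {c : ℝ} (hc : g c = h c) : g = h := by
  funext x
  have := is_const_of_deriv_eq_zero (f := fun y => g y - h y)
    (fun y => ((hg y).sub (hh y)).differentiableAt)
    (fun y => (((hg y).sub (hh y)).congr_deriv (sub_self _)).deriv) x c
  simp only [hc, sub_self] at this
  linarith

theorem periodic_of_hasDerivAt {g g' : ℝ → ℝ} {T c : ℝ} (h : ∀ x, HasDerivAt g (g' x) x)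
    (hp : Function.Periodic g' T) (hc : g (c + T) = g c) : Function.Periodic g T := by
  intro x
  refine congrFun (eq_of_hasDerivAt_of_eq (g := fun x => g (x + T)) (fun x => ?_) h hc) x
  simpa [hp x] using (h (x + T)).comp_add_const x T

theorem even_of_hasDerivAt {g g' : ℝ → ℝ} (h : ∀ x, HasDerivAt g (g' x) x)
    (hodd : ∀ x, g' (-x) = -g' x) (x : ℝ) : g (-x) = g x := by
  refine congrFun (eq_of_hasDerivAt_of_eq (g := fun x => g (-x)) (c := 0) (fun x => ?_) h
    (by simp)) x
  simpa [hodd, Function.comp_def] using (h (-x)).comp x (hasDerivAt_neg x)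

theorem odd_of_hasDerivAt {g g' : ℝ → ℝ} (h : ∀ x, HasDerivAt g (g' x) x)
    (heven : ∀ x, g' (-x) = g' x) (h0 : g 0 = 0) (x : ℝ) : g (-x) = -g x := by
  have := congrFun (eq_of_hasDerivAt_of_eq (g := fun x => -g (-x)) (c := 0) (fun x => ?_) h
    (by simp [h0])) x
  · linarith
  · simpa [heven, Function.comp_def, Pi.neg_def] using ((h (-x)).comp x (hasDerivAt_neg x)).neg

theorem deriv_even_of_hasDerivAt {g g' : ℝ → ℝ} (h : ∀ x, HasDerivAt g (g' x) x)
    (hodd : ∀ x, g (-x) = -g x) (x : ℝ) : g' (-x) = g' x := by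
  have h1 : HasDerivAt (fun y => g (-y)) (-g' (-x)) x := by
    simpa [Function.comp_def] using (h (-x)).comp x (hasDerivAt_neg x)
  rw [funext hodd] at h1
  linarith [h1.unique (h x).neg]

theorem deriv_antiperiodic_of_hasDerivAt {g g' : ℝ → ℝ} {T : ℝ} (h : ∀ x, HasDerivAt g (g' x) x)
    (hp : ∀ x, g (x + T) = -g x) (x : ℝ) : g' (x + T) = -g' x := by
  have h1 : HasDerivAt (fun y => g (y + T)) (g' (x + T)) x := (h (x + T)).comp_add_const x T
  rw [funext hp] at h1
  exact h1.unique (h x).neg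

theorem contDiff_two_of_hasDerivAt {g g' g'' : ℝ → ℝ} (h : ∀ x, HasDerivAt g (g' x) x)
    (h' : ∀ x, HasDerivAt g' (g'' x) x) (hc : Continuous g'') : ContDiff ℝ 2 g := by
  have e : deriv g = g' := funext fun x => (h x).deriv
  have e' : deriv g' = g'' := funext fun x => (h' x).deriv
  rw [show (2 : WithTop ℕ∞) = 1 + 1 by norm_num, contDiff_succ_iff_deriv, e]
  refine ⟨fun x => (h x).differentiableAt, by simp, ?_⟩
  rw [contDiff_one_iff_deriv, e']
  exact ⟨fun x => (h' x).differentiableAt, hc⟩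

theorem iteratedDeriv_two_eq_of_hasDerivAt {g g' g'' : ℝ → ℝ} (h : ∀ x, HasDerivAt g (g' x) x)
    (h' : ∀ x, HasDerivAt g' (g'' x) x) : iteratedDeriv 2 g = g'' := by
  rw [iteratedDeriv_succ, iteratedDeriv_one, funext fun x => (h x).deriv]
  exact funext fun x => (h' x).deriv

/-! ### Functions on the circle -/

instance fact_two_pi_pos : Fact (0 < 2 * Real.pi) := ⟨Real.two_pi_pos⟩

/-- The circle `ℝ / 2πℤ`. -/
abbrev Circ := AddCircle (2 * Real.pi)

/-- A continuous `2π`-periodic function as a function on the circle. -/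
def toCirc (g : ℝ → ℝ) (hc : Continuous g) (hp : Function.Periodic g (2 * Real.pi)) :
    C(Circ, ℝ) where
  toFun := hp.lift
  continuous_toFun := continuous_coinduced_dom.mpr hc

theorem circ_ext {f g : C(Circ, ℝ)} (h : ∀ x : ℝ, f (x : Circ) = g (x : Circ)) : f = g := by
  ext x
  induction x using QuotientAddGroup.induction_on with
  | H x => exact h x

theorem circ_norm_le {f : C(Circ, ℝ)} {M : ℝ} (hM : 0 ≤ M) (h : ∀ x : ℝ, |f (x : Circ)| ≤ M) :
    ‖f‖ ≤ M := by
  rw [ContinuousMap.norm_le _ hM]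
  intro x
  induction x using QuotientAddGroup.induction_on with
  | H x => exact h x

theorem continuous_circ_coe (f : C(Circ, ℝ)) : Continuous fun x : ℝ => f (x : Circ) :=
  f.continuous.comp (AddCircle.continuous_mk' _)

theorem periodic_circ_coe (f : C(Circ, ℝ)) :
    Function.Periodic (fun x : ℝ => f (x : Circ)) (2 * Real.pi) := fun x => by
  simp only [AddCircle.coe_add_period]

/-- Translation of functions on the circle. -/
def shift (c : ℝ) : C(Circ, ℝ) →L[ℝ] C(Circ, ℝ) :=
  ContinuousMap.compCLM ℝ ℝ ⟨fun x : Circ => x + (c : Circ), continuous_add_const _⟩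

/-! ### Inversion of the second derivative on odd functions -/

/-- The odd part of a function on the circle, as a function on the line. -/
def oddPart (f : C(Circ, ℝ)) (x : ℝ) : ℝ := (f (x : Circ) - f ((-x : ℝ) : Circ)) / 2

theorem continuous_oddPart (f : C(Circ, ℝ)) : Continuous (oddPart f) :=
  ((continuous_circ_coe f).sub ((continuous_circ_coe f).comp continuous_neg)).div_const 2

theorem oddPart_neg (f : C(Circ, ℝ)) (x : ℝ) : oddPart f (-x) = -oddPart f x := by
  rw [oddPart, oddPart, neg_neg]; ring

theorem periodic_oddPart (f : C(Circ, ℝ)) : Function.Periodic (oddPart f) (2 * Real.pi) := by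
  intro x
  have h1 := periodic_circ_coe f x
  have h2 := periodic_circ_coe f (-(x + 2 * Real.pi))
  simp only [neg_add, neg_add_cancel_right] at h1 h2
  rw [oddPart, oddPart, h1, neg_add, ← h2]

theorem oddPart_eq_self {f : C(Circ, ℝ)} (h : ∀ x : ℝ, f ((-x : ℝ) : Circ) = -f (x : Circ))
    (x : ℝ) : oddPart f x = f (x : Circ) := by
  rw [oddPart, h]; ring

theorem abs_oddPart_le (f : C(Circ, ℝ)) (x : ℝ) : |oddPart f x| ≤ ‖f‖ := by
  have h1 := abs_le.mp (f.norm_coe_le_norm (x : Circ))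
  have h2 := abs_le.mp (f.norm_coe_le_norm ((-x : ℝ) : Circ))
  rw [oddPart, abs_le]
  constructor <;> linarith [h1.1, h1.2, h2.1, h2.2]

theorem oddPart_add (f g : C(Circ, ℝ)) (x : ℝ) :
    oddPart (f + g) x = oddPart f x + oddPart g x := by
  simp only [oddPart, ContinuousMap.add_apply]; ring

theorem oddPart_smul (c : ℝ) (f : C(Circ, ℝ)) (x : ℝ) :
    oddPart (c • f) x = c * oddPart f x := by
  simp only [oddPart, ContinuousMap.smul_apply, smul_eq_mul]; ring

/-- The primitive of the odd part that vanishes at `0`. -/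
def prim (f : C(Circ, ℝ)) (x : ℝ) : ℝ := ∫ s in (0)..x, oddPart f s

theorem hasDerivAt_prim (f : C(Circ, ℝ)) (x : ℝ) : HasDerivAt (prim f) (oddPart f x) x :=
  intervalIntegral.integral_hasDerivAt_right ((continuous_oddPart f).intervalIntegrable _ _)
    ((continuous_oddPart f).stronglyMeasurableAtFilter _ _) (continuous_oddPart f).continuousAt

theorem continuous_prim (f : C(Circ, ℝ)) : Continuous (prim f) :=
  continuous_iff_continuousAt.mpr fun x => (hasDerivAt_prim f x).continuousAt

theorem prim_neg (f : C(Circ, ℝ)) (x : ℝ) : prim f (-x) = prim f x :=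
  even_of_hasDerivAt (hasDerivAt_prim f) (oddPart_neg f) x

/-- An even function takes equal values at `-π` and `π`, and with a periodic derivative one such
coincidence suffices. -/
theorem periodic_prim (f : C(Circ, ℝ)) : Function.Periodic (prim f) (2 * Real.pi) :=
  periodic_of_hasDerivAt (c := -Real.pi) (hasDerivAt_prim f) (periodic_oddPart f) (by
    rw [prim_neg]; congr 1; ring)

/-- The mean value of `prim f`. -/
def primMean (f : C(Circ, ℝ)) : ℝ := (2 * Real.pi)⁻¹ * ∫ s in (0)..(2 * Real.pi), prim f s

/-- The derivative of `sol f`. -/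
def slope (f : C(Circ, ℝ)) (x : ℝ) : ℝ := prim f x - primMean f

/-- The odd periodic function whose second derivative is the odd part of `f`. -/
def sol (f : C(Circ, ℝ)) (x : ℝ) : ℝ := ∫ s in (0)..x, slope f s

theorem hasDerivAt_slope (f : C(Circ, ℝ)) (x : ℝ) : HasDerivAt (slope f) (oddPart f x) x :=
  (hasDerivAt_prim f x).sub_const _

theorem continuous_slope (f : C(Circ, ℝ)) : Continuous (slope f) :=
  (continuous_prim f).sub continuous_const

theorem hasDerivAt_sol (f : C(Circ, ℝ)) (x : ℝ) : HasDerivAt (sol f) (slope f x) x :=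
  intervalIntegral.integral_hasDerivAt_right ((continuous_slope f).intervalIntegrable _ _)
    ((continuous_slope f).stronglyMeasurableAtFilter _ _) (continuous_slope f).continuousAt

theorem continuous_sol (f : C(Circ, ℝ)) : Continuous (sol f) :=
  continuous_iff_continuousAt.mpr fun x => (hasDerivAt_sol f x).continuousAt

theorem periodic_slope (f : C(Circ, ℝ)) : Function.Periodic (slope f) (2 * Real.pi) := fun x => by
  rw [slope, slope, periodic_prim f x]

theorem slope_neg (f : C(Circ, ℝ)) (x : ℝ) : slope f (-x) = slope f x := by
  rw [slope, slope, prim_neg]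

@[simp]
theorem sol_zero (f : C(Circ, ℝ)) : sol f 0 = 0 := intervalIntegral.integral_same

theorem sol_neg (f : C(Circ, ℝ)) (x : ℝ) : sol f (-x) = -sol f x :=
  odd_of_hasDerivAt (hasDerivAt_sol f) (slope_neg f) (sol_zero f) x

/-- Subtracting the mean in `slope` makes its integral over a period vanish. -/
theorem periodic_sol (f : C(Circ, ℝ)) : Function.Periodic (sol f) (2 * Real.pi) := by
  refine periodic_of_hasDerivAt (c := 0) (hasDerivAt_sol f) (periodic_slope f) ?_
  rw [zero_add, sol_zero, sol]
  simp only [slope]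
  rw [intervalIntegral.integral_sub ((continuous_prim f).intervalIntegrable _ _)
    (continuous_const.intervalIntegrable _ _), intervalIntegral.integral_const, primMean]
  have := Real.pi_ne_zero
  simp only [sub_zero, smul_eq_mul]
  field_simp
  ring

theorem contDiff_sol (f : C(Circ, ℝ)) : ContDiff ℝ 2 (sol f) :=
  contDiff_two_of_hasDerivAt (hasDerivAt_sol f) (hasDerivAt_slope f) (continuous_oddPart f)

theorem abs_prim_le (f : C(Circ, ℝ)) (x : ℝ) : |prim f x| ≤ 2 * Real.pi * ‖f‖ := by
  obtain ⟨y, hy, he⟩ := (periodic_prim f).exists_mem_Ico₀ Real.two_pi_pos x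
  rw [he]
  have := intervalIntegral.norm_integral_le_of_norm_le_const (a := 0) (b := y)
    (f := oddPart f) (fun s _ => abs_oddPart_le f s)
  rw [sub_zero, abs_of_nonneg hy.1] at this
  refine this.trans ?_
  rw [mul_comm]
  exact mul_le_mul_of_nonneg_right hy.2.le (norm_nonneg _)

theorem abs_primMean_le (f : C(Circ, ℝ)) : |primMean f| ≤ 2 * Real.pi * ‖f‖ := by
  have := intervalIntegral.norm_integral_le_of_norm_le_const (a := 0) (b := 2 * Real.pi)
    (f := prim f) (fun s _ => abs_prim_le f s)
  rw [sub_zero, abs_of_pos Real.two_pi_pos, Real.norm_eq_abs] at this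
  rw [primMean, abs_mul, abs_of_pos (inv_pos.mpr Real.two_pi_pos), inv_mul_le_iff₀ Real.two_pi_pos]
  linarith

theorem abs_slope_le (f : C(Circ, ℝ)) (x : ℝ) : |slope f x| ≤ 4 * Real.pi * ‖f‖ := by
  have h1 := abs_le.mp (abs_prim_le f x)
  have h2 := abs_le.mp (abs_primMean_le f)
  rw [slope, abs_le]
  constructor <;> linarith [h1.1, h1.2, h2.1, h2.2]

theorem abs_sol_le (f : C(Circ, ℝ)) (x : ℝ) : |sol f x| ≤ 2 * Real.pi * (4 * Real.pi * ‖f‖) := by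
  obtain ⟨y, hy, he⟩ := (periodic_sol f).exists_mem_Ico₀ Real.two_pi_pos x
  rw [he]
  have := intervalIntegral.norm_integral_le_of_norm_le_const (a := 0) (b := y)
    (f := slope f) (fun s _ => abs_slope_le f s)
  rw [sub_zero, abs_of_nonneg hy.1] at this
  refine this.trans ?_
  rw [mul_comm]
  exact mul_le_mul_of_nonneg_right hy.2.le (by positivity)

/-- An odd periodic function is determined by its second derivative. -/
theorem eq_of_second_deriv_eq {w v w' v' g : ℝ → ℝ} (hw : ∀ x, HasDerivAt w (w' x) x)
    (hw' : ∀ x, HasDerivAt w' (g x) x) (hv : ∀ x, HasDerivAt v (v' x) x)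
    (hv' : ∀ x, HasDerivAt v' (g x) x) (w0 : w 0 = 0) (v0 : v 0 = 0)
    (hwp : w (2 * Real.pi) = 0) (hvp : v (2 * Real.pi) = 0) : w = v := by
  -- The difference `w - v` is affine; its zeros at `0` and `2π` make it vanish.
  have key : ∀ x, w' x = v' x + (w' 0 - v' 0) := fun x => by
    have := congrFun (eq_of_hasDerivAt_of_eq (c := 0) hw'
      (fun x => (hv' x).add_const (w' 0 - v' 0)) (by ring)) x
    exact this
  have key2 := eq_of_hasDerivAt_of_eq (c := 0) hw (h := fun x => v x + (w' 0 - v' 0) * x)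
    (fun x => by
      have := (hv x).add ((hasDerivAt_id x).const_mul (w' 0 - v' 0))
      rw [mul_one, ← key x] at this
      exact this) (by simp [w0, v0])
  have h := congrFun key2 (2 * Real.pi)
  simp only [hwp, hvp, zero_add] at h
  have h0 : w' 0 - v' 0 = 0 := by
    rcases mul_eq_zero.mp h.symm with h | h
    · exact h
    · exact absurd h Real.two_pi_pos.ne'
  rw [key2, h0]
  simp

theorem sol_unique {f : C(Circ, ℝ)} {w w' : ℝ → ℝ} (hw : ∀ x, HasDerivAt w (w' x) x)
    (hw' : ∀ x, HasDerivAt w' (oddPart f x) x) (w0 : w 0 = 0) (hwp : w (2 * Real.pi) = 0) :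
    w = sol f :=
  eq_of_second_deriv_eq hw hw' (hasDerivAt_sol f) (hasDerivAt_slope f) w0 (sol_zero f) hwp
    (by have := periodic_sol f 0; rwa [zero_add, sol_zero] at this)

theorem prim_add (f g : C(Circ, ℝ)) (x : ℝ) : prim (f + g) x = prim f x + prim g x := by
  simp only [prim, oddPart_add]
  exact intervalIntegral.integral_add ((continuous_oddPart f).intervalIntegrable _ _)
    ((continuous_oddPart g).intervalIntegrable _ _)

theorem prim_smul (c : ℝ) (f : C(Circ, ℝ)) (x : ℝ) : prim (c • f) x = c * prim f x := by
  simp only [prim, oddPart_smul]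
  exact intervalIntegral.integral_const_mul _ _

theorem slope_add (f g : C(Circ, ℝ)) (x : ℝ) : slope (f + g) x = slope f x + slope g x := by
  have : primMean (f + g) = primMean f + primMean g := by
    simp only [primMean, prim_add]
    rw [intervalIntegral.integral_add ((continuous_prim f).intervalIntegrable _ _)
      ((continuous_prim g).intervalIntegrable _ _), mul_add]
  simp only [slope, prim_add, this]
  ring

theorem slope_smul (c : ℝ) (f : C(Circ, ℝ)) (x : ℝ) : slope (c • f) x = c * slope f x := by
  have : primMean (c • f) = c * primMean f := by
    simp only [primMean, prim_smul]
    rw [intervalIntegral.integral_const_mul]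
    ring
  simp only [slope, prim_smul, this]
  ring

theorem sol_add (f g : C(Circ, ℝ)) (x : ℝ) : sol (f + g) x = sol f x + sol g x := by
  simp only [sol, slope_add]
  exact intervalIntegral.integral_add ((continuous_slope f).intervalIntegrable _ _)
    ((continuous_slope g).intervalIntegrable _ _)

theorem sol_smul (c : ℝ) (f : C(Circ, ℝ)) (x : ℝ) : sol (c • f) x = c * sol f x := by
  simp only [sol, slope_smul]
  exact intervalIntegral.integral_const_mul _ _

/-- `sol` as a bounded operator. -/
def solL : C(Circ, ℝ) →L[ℝ] C(Circ, ℝ) :=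
  LinearMap.mkContinuous
    { toFun := fun f => toCirc (sol f) (continuous_sol f) (periodic_sol f)
      map_add' := fun f g => circ_ext fun x => sol_add f g x
      map_smul' := fun c f => circ_ext fun x => sol_smul c f x } (2 * Real.pi * (4 * Real.pi))
    fun f => circ_norm_le (by positivity) fun x => by
      rw [mul_assoc]
      exact abs_sol_le f x

/-- `slope` as a bounded operator. -/
def slopeL : C(Circ, ℝ) →L[ℝ] C(Circ, ℝ) :=
  LinearMap.mkContinuous
    { toFun := fun f => toCirc (slope f) (continuous_slope f) (periodic_slope f)
      map_add' := fun f g => circ_ext fun x => slope_add f g x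
      map_smul' := fun c f => circ_ext fun x => slope_smul c f x } (4 * Real.pi)
    fun f => circ_norm_le (by positivity) fun x => abs_slope_le f x

/-- `sol` as a bounded operator with values in `C²_per`. -/
def solCPer : C(Circ, ℝ) →L[ℝ] CPer 2 :=
  LinearMap.mkContinuous
    { toFun := fun f => (⟨sol f, contDiff_sol f, periodic_sol f⟩ : cPerSubmodule 2)
      map_add' := fun f g => Subtype.ext (funext fun x => sol_add f g x)
      map_smul' := fun c f => Subtype.ext (funext fun x => sol_smul c f x) }
    (2 * Real.pi * (4 * Real.pi) + 4 * Real.pi + 1)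
    fun f => by
      have hf := norm_nonneg f
      have hpi := Real.pi_pos
      have h1 : 0 ≤ 2 * Real.pi * (4 * Real.pi * ‖f‖) := by positivity
      have h2 : 0 ≤ 4 * Real.pi * ‖f‖ := by positivity
      refine (pi_norm_le_iff_of_nonneg (by positivity)).mpr fun i => ?_
      refine (BoundedContinuousFunction.norm_le (by positivity)).mpr fun x => ?_
      change |iteratedDeriv (i : ℕ) (sol f) x| ≤ _
      fin_cases i
      · have := abs_sol_le f x
        simp only [iteratedDeriv_zero]
        linarith
      · have := abs_slope_le f x
        simp only [iteratedDeriv_one, (hasDerivAt_sol f x).deriv]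
        linarith
      · have := abs_oddPart_le f x
        simp only [iteratedDeriv_two_eq_of_hasDerivAt (hasDerivAt_sol f) (hasDerivAt_slope f)]
        linarith

/-- The second derivative of `sol f` is bounded by `‖f‖`, so the Taylor remainder is at most `h²
‖f‖`, uniformly in `f`: this gives differentiability in operator norm. -/
theorem hasDerivAt_shift_comp_solL (c : ℝ) :
    HasDerivAt (fun c => shift c ∘L solL) (shift c ∘L slopeL) c := by
  refine (hasDerivAt_iff_isLittleO_nhds_zero (𝕜 := ℝ) (F := C(Circ, ℝ) →L[ℝ] C(Circ, ℝ))).mpr ?_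
  refine IsBigO.trans_isLittleO (g := fun h : ℝ => h * h) ?_ ?_
  · refine IsBigO.of_bound 1 (Eventually.of_forall fun h => ?_)
    refine ContinuousLinearMap.opNorm_le_bound _ (by positivity) fun f => ?_
    refine circ_norm_le (by positivity) fun x => ?_
    have := abs_taylor_two_le (hasDerivAt_sol f) (hasDerivAt_slope f) (abs_oddPart_le f) (x + c) h
    rw [one_mul, norm_mul, Real.norm_eq_abs]
    refine le_trans (le_of_eq ?_) (this.trans (le_of_eq (by ring)))
    change |sol f (x + (c + h)) - sol f (x + c) - h * slope f (x + c)| = _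
    rw [add_assoc]
  · simpa [sq] using isLittleO_pow_id (𝕜 := ℝ) (n := 2) (by norm_num)

/-- The derivative is Lipschitz in `c`, since `slope f` is `‖f‖`-Lipschitz. -/
theorem contDiff_shift_comp_solL : ContDiff ℝ 1 (fun c => shift c ∘L solL) := by
  have e : deriv (fun c => shift c ∘L solL) = fun c => shift c ∘L slopeL :=
    funext fun c => HasDerivAt.deriv (𝕜 := ℝ) (F := C(Circ, ℝ) →L[ℝ] C(Circ, ℝ)) (hasDerivAt_shift_comp_solL c)
  rw [contDiff_one_iff_deriv, e]
  refine ⟨fun c => (hasDerivAt_shift_comp_solL c).differentiableAt, ?_⟩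
  refine LipschitzWith.continuous (K := 1) (LipschitzWith.of_dist_le_mul fun c d => ?_)
  rw [dist_eq_norm]
  refine ContinuousLinearMap.opNorm_le_bound _ (by positivity) fun f => ?_
  refine circ_norm_le (by positivity) fun x => ?_
  have := abs_sub_le_of_hasDerivAt (hasDerivAt_slope f) (abs_oddPart_le f) (x + d) (x + c)
  rw [add_sub_add_left_eq_sub] at this
  rw [NNReal.coe_one, one_mul, Real.dist_eq]
  exact this.trans (mul_comm _ _).le

/-! ### The Beta integral in trigonometric form -/

/-- Real part of the complex Beta integral, whose convergence supplies integrability at both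
endpoint singularities. -/
theorem real_beta_integrableOn_and_integral {a b : ℝ} (ha : 0 < a) (hb : 0 < b) :
    MeasureTheory.IntegrableOn (fun x : ℝ => x ^ (a - 1) * (1 - x) ^ (b - 1)) (Ioo 0 1) ∧
      ∫ x in Ioo (0 : ℝ) 1, x ^ (a - 1) * (1 - x) ^ (b - 1) = ProbabilityTheory.beta a b := by
  have hc := Complex.betaIntegral_convergent (u := a) (v := b) (by simpa) (by simpa)
  rw [intervalIntegrable_iff_integrableOn_Ioo_of_le zero_le_one] at hc
  have he : EqOn (fun x : ℝ => ((x : ℂ) ^ ((a : ℂ) - 1) * (1 - (x : ℂ)) ^ ((b : ℂ) - 1)).re)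
      (fun x : ℝ => x ^ (a - 1) * (1 - x) ^ (b - 1)) (Ioo 0 1) := by
    intro x hx
    have h1 : (x : ℂ) ^ ((a : ℂ) - 1) = ((x ^ (a - 1) : ℝ) : ℂ) := by
      rw [Complex.ofReal_cpow hx.1.le]; push_cast; rfl
    have h2 : (1 - (x : ℂ)) ^ ((b : ℂ) - 1) = (((1 - x) ^ (b - 1) : ℝ) : ℂ) := by
      rw [Complex.ofReal_cpow (by linarith [hx.2])]; push_cast; rfl
    simp only [h1, h2, ← Complex.ofReal_mul, Complex.ofReal_re]
  refine ⟨(MeasureTheory.IntegrableOn.congr_fun hc.re he measurableSet_Ioo), ?_⟩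
  rw [ProbabilityTheory.beta_eq_betaIntegralReal a b ha hb, Complex.betaIntegral,
    intervalIntegral.integral_of_le zero_le_one, MeasureTheory.integral_Ioc_eq_integral_Ioo,
    ← MeasureTheory.setIntegral_congr_fun measurableSet_Ioo he]
  exact integral_re hc

/-- The density `|sin θ| ^ (2 b - 1)`, regularized at the zeros of `sin`. -/
def sinDensity (b θ : ℝ) : ℝ := if Real.sin θ = 0 then 1 else |Real.sin θ| ^ (2 * b - 1)

theorem sinDensity_pos (b θ : ℝ) : 0 < sinDensity b θ := by
  rw [sinDensity]
  split_ifs with h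
  · exact one_pos
  · exact Real.rpow_pos_of_pos (abs_pos.mpr h) _

theorem sinDensity_neg (b θ : ℝ) : sinDensity b (-θ) = sinDensity b θ := by
  simp only [sinDensity, Real.sin_neg, neg_eq_zero, abs_neg]

theorem periodic_sinDensity (b : ℝ) : Function.Periodic (sinDensity b) Real.pi := fun θ => by
  simp only [sinDensity, Real.sin_add_pi, neg_eq_zero, abs_neg]

theorem sin_sq_image : (fun θ => Real.sin θ ^ 2) '' Ioo 0 (Real.pi / 2) = Ioo 0 1 := by
  have hpi := Real.pi_pos
  ext s
  constructor
  · rintro ⟨θ, hθ, rfl⟩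
    have h1 : 0 < Real.sin θ := Real.sin_pos_of_pos_of_lt_pi hθ.1 (by linarith [hθ.2])
    have h2 : 0 < Real.cos θ := Real.cos_pos_of_mem_Ioo ⟨by linarith [hθ.1], hθ.2⟩
    exact ⟨by positivity, by nlinarith [Real.sin_sq_add_cos_sq θ]⟩
  · rintro ⟨h0, h1⟩
    have hs : √s < 1 := by rw [Real.sqrt_lt' one_pos]; simpa
    refine ⟨Real.arcsin √s, ⟨Real.arcsin_pos.mpr (Real.sqrt_pos.mpr h0),
      Real.arcsin_lt_pi_div_two.mpr hs⟩, ?_⟩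
    dsimp only
    rw [Real.sin_arcsin (by linarith [Real.sqrt_nonneg s]) hs.le, Real.sq_sqrt h0.le]

/-- Substitute `s = sin² θ` in the Beta integral; the factor `(1 - s)^(-1/2)` cancels the cosine of
the Jacobian. -/
theorem sinDensity_integrableOn_and_integral {b : ℝ} (hb : 0 < b) :
    MeasureTheory.IntegrableOn (sinDensity b) (Ioo 0 (Real.pi / 2)) ∧
      2 * ∫ θ in Ioo 0 (Real.pi / 2), sinDensity b θ = ProbabilityTheory.beta b (1 / 2) := by
  have hpi := Real.pi_pos
  obtain ⟨h1, h2⟩ := real_beta_integrableOn_and_integral hb (b := 1 / 2) (by norm_num)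
  have hd : ∀ θ ∈ Ioo 0 (Real.pi / 2), HasDerivWithinAt (fun θ => Real.sin θ ^ 2)
      (2 * Real.sin θ * Real.cos θ) (Ioo 0 (Real.pi / 2)) θ := fun θ _ => by
    have := ((Real.hasDerivAt_sin θ).pow 2).hasDerivWithinAt (s := Ioo 0 (Real.pi / 2))
    refine this.congr_deriv ?_
    simp
  have hpos : ∀ θ ∈ Ioo 0 (Real.pi / 2), 0 < Real.sin θ ∧ 0 < Real.cos θ := fun θ hθ =>
    ⟨Real.sin_pos_of_pos_of_lt_pi hθ.1 (by linarith [hθ.2]),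
      Real.cos_pos_of_mem_Ioo ⟨by linarith [hθ.1], hθ.2⟩⟩
  have hinj : InjOn (fun θ => Real.sin θ ^ 2) (Ioo 0 (Real.pi / 2)) := by
    intro x hx y hy h
    have := (sq_eq_sq₀ (hpos x hx).1.le (hpos y hy).1.le).mp h
    exact Real.injOn_sin ⟨by linarith [hx.1], hx.2.le⟩ ⟨by linarith [hy.1], hy.2.le⟩ this
  have he : EqOn (fun θ => |2 * Real.sin θ * Real.cos θ| • ((Real.sin θ ^ 2) ^ (b - 1) *
      (1 - Real.sin θ ^ 2) ^ ((1 / 2 : ℝ) - 1))) (fun θ => 2 * sinDensity b θ)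
      (Ioo 0 (Real.pi / 2)) := by
    intro θ hθ
    obtain ⟨hs, hc⟩ := hpos θ hθ
    have e1 : 1 - Real.sin θ ^ 2 = Real.cos θ ^ 2 := by linarith [Real.sin_sq_add_cos_sq θ]
    have e2 : (Real.cos θ ^ 2) ^ ((1 / 2 : ℝ) - 1) = (Real.cos θ)⁻¹ := by
      rw [← Real.rpow_natCast, ← Real.rpow_mul hc.le, ← Real.rpow_neg_one]
      norm_num
    have e3 : Real.sin θ * (Real.sin θ ^ 2) ^ (b - 1) = Real.sin θ ^ (2 * b - 1) := by
      nth_rw 1 [← Real.rpow_one (Real.sin θ)]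
      rw [← Real.rpow_natCast, ← Real.rpow_mul hs.le, ← Real.rpow_add hs]
      congr 1; push_cast; ring
    simp only [e1, e2, smul_eq_mul, sinDensity, if_neg hs.ne', abs_of_pos hs,
      abs_of_pos (mul_pos (mul_pos two_pos hs) hc)]
    rw [← e3]
    field_simp
  constructor
  · rw [← sin_sq_image,
      MeasureTheory.integrableOn_image_iff_integrableOn_abs_deriv_smul measurableSet_Ioo hd hinj,
      MeasureTheory.integrableOn_congr_fun he measurableSet_Ioo] at h1
    simpa [MeasureTheory.IntegrableOn] using MeasureTheory.Integrable.const_mul h1 (1 / 2)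
  · rw [← sin_sq_image,
      MeasureTheory.integral_image_eq_integral_abs_deriv_smul measurableSet_Ioo hd hinj,
      MeasureTheory.setIntegral_congr_fun measurableSet_Ioo he,
      MeasureTheory.integral_const_mul] at h2
    exact h2

theorem intervalIntegrable_sinDensity {b : ℝ} (hb : 0 < b) (x y : ℝ) :
    IntervalIntegrable (sinDensity b) MeasureTheory.volume x y := by
  have hpi := Real.pi_pos
  have h1 : IntervalIntegrable (sinDensity b) MeasureTheory.volume 0 (Real.pi / 2) := by
    rw [intervalIntegrable_iff_integrableOn_Ioo_of_le (by linarith)]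
    exact (sinDensity_integrableOn_and_integral hb).1
  have h2 : IntervalIntegrable (sinDensity b) MeasureTheory.volume (-(Real.pi / 2)) 0 := by
    rw [IntervalIntegrable.iff_comp_neg]
    simpa [sinDensity_neg] using h1.symm
  refine (periodic_sinDensity b).intervalIntegrable hpi.ne' (t := -(Real.pi / 2)) ?_ x y
  convert h2.trans h1 using 1
  ring

theorem integral_sinDensity {b : ℝ} (hb : 0 < b) :
    ∫ θ in (0)..Real.pi, sinDensity b θ = ProbabilityTheory.beta b (1 / 2) := by
  have hpi := Real.pi_pos
  rw [← (sinDensity_integrableOn_and_integral hb).2, ← MeasureTheory.integral_Ioc_eq_integral_Ioo,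
    ← intervalIntegral.integral_of_le (by linarith)]
  have h1 := (periodic_sinDensity b).intervalIntegral_add_eq (-(Real.pi / 2)) 0
  rw [zero_add, show -(Real.pi / 2) + Real.pi = Real.pi / 2 by ring] at h1
  rw [← h1, ← intervalIntegral.integral_add_adjacent_intervals
    (intervalIntegrable_sinDensity hb _ 0) (intervalIntegrable_sinDensity hb 0 _), two_mul]
  congr 1
  have := intervalIntegral.integral_comp_neg (a := 0) (b := Real.pi / 2) (sinDensity b)
  simp only [sinDensity_neg, neg_zero] at this
  exact this.symm

/-! ### The phase function of the binary oscillation -/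

/-- The time at which the phase `θ` is reached, normalized to `π` at `θ = π`. -/
def phaseTime (b θ : ℝ) : ℝ :=
  Real.pi / ProbabilityTheory.beta b (1 / 2) * ∫ s in (0)..θ, sinDensity b s

theorem pi_div_beta_pos {b : ℝ} (hb : 0 < b) :
    0 < Real.pi / ProbabilityTheory.beta b (1 / 2) :=
  div_pos Real.pi_pos (ProbabilityTheory.beta_pos hb (by norm_num))

theorem continuous_phaseTime {b : ℝ} (hb : 0 < b) : Continuous (phaseTime b) :=
  (intervalIntegral.continuous_primitive (intervalIntegrable_sinDensity hb) 0).const_mul _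

theorem strictMono_phaseTime {b : ℝ} (hb : 0 < b) : StrictMono (phaseTime b) := by
  intro x y hxy
  have h := intervalIntegral.intervalIntegral_pos_of_pos_on
    (intervalIntegrable_sinDensity hb x y) (fun s _ => sinDensity_pos b s) hxy
  rw [← intervalIntegral.integral_interval_sub_left (intervalIntegrable_sinDensity hb 0 y)
    (intervalIntegrable_sinDensity hb 0 x), sub_pos] at h
  exact mul_lt_mul_of_pos_left h (pi_div_beta_pos hb)

theorem phaseTime_add_pi {b : ℝ} (hb : 0 < b) (θ : ℝ) :
    phaseTime b (θ + Real.pi) = phaseTime b θ + Real.pi := by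
  have hB := ProbabilityTheory.beta_pos hb (β := 1 / 2) (by norm_num)
  rw [phaseTime, phaseTime, ← intervalIntegral.integral_add_adjacent_intervals
    (intervalIntegrable_sinDensity hb 0 θ) (intervalIntegrable_sinDensity hb θ _),
    (periodic_sinDensity b).intervalIntegral_add_eq θ 0, zero_add, integral_sinDensity hb, mul_add,
    div_mul_cancel₀ _ hB.ne']

theorem phaseTime_neg (b θ : ℝ) : phaseTime b (-θ) = -phaseTime b θ := by
  have := intervalIntegral.integral_comp_neg (a := 0) (b := θ) (sinDensity b)
  simp only [sinDensity_neg, neg_zero] at this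
  rw [phaseTime, phaseTime, this, intervalIntegral.integral_symm]
  ring

/-- `phaseTime` fixes every integer multiple of `π`, so the intermediate value theorem applies
between consecutive multiples. -/
theorem phaseTime_surjective {b : ℝ} (hb : 0 < b) : Function.Surjective (phaseTime b) := by
  intro y
  have hper : Function.Periodic (fun θ => phaseTime b θ - θ) Real.pi := fun θ => by
    simp only [phaseTime_add_pi hb]; ring
  have hn : ∀ n : ℤ, phaseTime b (n * Real.pi) = n * Real.pi := fun n => by
    have := hper.int_mul n 0
    simp only [zero_add, sub_zero] at this
    have h0 : phaseTime b 0 = 0 := by simp [phaseTime]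
    linarith
  have hpi := Real.pi_pos
  have h1 := Int.floor_le (y / Real.pi)
  have h2 := Int.lt_floor_add_one (y / Real.pi)
  rw [le_div_iff₀ hpi] at h1
  rw [div_lt_iff₀ hpi] at h2
  have hle : (⌊y / Real.pi⌋ : ℝ) * Real.pi ≤ ((⌊y / Real.pi⌋ + 1 : ℤ) : ℝ) * Real.pi := by
    push_cast; linarith
  obtain ⟨θ, -, hθ⟩ := intermediate_value_Icc hle (continuous_phaseTime hb).continuousOn
    (show y ∈ Icc _ _ from ⟨by rw [hn]; exact h1, by rw [hn]; push_cast; exact h2.le⟩)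
  exact ⟨θ, hθ⟩

/-- `phaseTime` as an order isomorphism of the line. -/
def phaseTimeIso {b : ℝ} (hb : 0 < b) : ℝ ≃o ℝ :=
  StrictMono.orderIsoOfSurjective _ (strictMono_phaseTime hb) (phaseTime_surjective hb)

/-- The fundamental theorem of calculus tolerates countably many exceptional points. This covers the
turning points of formulas involving `|sin Θ|`, where the chain rule breaks down. -/
theorem hasDerivAt_of_hasDerivAt_off_countable {f f' : ℝ → ℝ} (hf : Continuous f)
    (hf' : Continuous f') {s : Set ℝ} (hs : s.Countable)
    (h : ∀ x ∉ s, HasDerivAt f (f' x) x) (x : ℝ) : HasDerivAt f (f' x) x := by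
  have e : f = fun x => f 0 + ∫ t in (0)..x, f' t := funext fun x => by
    rw [MeasureTheory.integral_eq_of_hasDerivAt_off_countable f f' hs hf.continuousOn
      (fun y hy => h y hy.2) (hf'.intervalIntegrable _ _)]
    ring
  have := (intervalIntegral.integral_hasDerivAt_right (hf'.intervalIntegrable 0 x)
    (hf'.stronglyMeasurableAtFilter _ _) hf'.continuousAt).const_add (f 0)
  rwa [← e] at this

/-- A phase function solves `θ' = c |sin θ|^{1 - 2b}` with `c = B(b, 1/2) / π`, is odd, and advances
by `π` in time `π`. -/
theorem exists_phase {b : ℝ} (hb : 0 < b) (hb2 : b < 1 / 2) : ∃ Θ : ℝ → ℝ,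
    (∀ x, HasDerivAt Θ (ProbabilityTheory.beta b (1 / 2) / Real.pi *
      |Real.sin (Θ x)| ^ (1 - 2 * b)) x) ∧
    {x | Real.sin (Θ x) = 0}.Countable ∧
    (∀ x, Θ (-x) = -Θ x) ∧ (∀ x, Θ (x + Real.pi) = Θ x + Real.pi) := by
  let Θ : ℝ → ℝ := fun x => (phaseTimeIso hb).symm x
  have hinv : ∀ x, phaseTime b (Θ x) = x := fun x => (phaseTimeIso hb).apply_symm_apply x
  have hcont : Continuous Θ := (phaseTimeIso hb).symm.continuous
  have hinj := (strictMono_phaseTime hb).injective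
  have hcount : {x | Real.sin (Θ x) = 0}.Countable := by
    have : {x | Real.sin (Θ x) = 0} ⊆ range fun n : ℤ => phaseTime b (n * Real.pi) := by
      intro x hx
      obtain ⟨n, hn⟩ := Real.sin_eq_zero_iff.mp hx
      exact ⟨n, by dsimp only; rw [hn, hinv]⟩
    exact (countable_range _).mono this
  refine ⟨Θ, ?_, hcount, fun x => hinj ?_, fun x => hinj ?_⟩
  · refine hasDerivAt_of_hasDerivAt_off_countable hcont ?_ hcount ?_
    · exact ((Real.continuous_sin.comp hcont).abs.rpow_const
        fun _ => Or.inr (by linarith)).const_mul _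
    · intro x hx
      have hx : Real.sin (Θ x) ≠ 0 := hx
      have hev : ∀ᶠ y in 𝓝 (Θ x), sinDensity b y = |Real.sin y| ^ (2 * b - 1) := by
        filter_upwards [Real.continuous_sin.continuousAt.eventually_ne hx] with y hy
        rw [sinDensity, if_neg hy]
      have hca : ContinuousAt (sinDensity b) (Θ x) := by
        refine ContinuousAt.congr ?_ (hev.mono fun y hy => hy.symm)
        exact Real.continuous_sin.continuousAt.abs.rpow_const (Or.inl (abs_ne_zero.mpr hx))
      have hmeas : Measurable (sinDensity b) := by
        refine Measurable.ite ?_ measurable_const ?_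
        · exact (measurableSet_singleton 0).preimage Real.measurable_sin
        · exact (Real.measurable_sin.norm).pow_const _
      have hd := (intervalIntegral.integral_hasDerivAt_right
        (intervalIntegrable_sinDensity hb 0 (Θ x))
        (hmeas.stronglyMeasurable.stronglyMeasurableAtFilter) hca).const_mul
        (Real.pi / ProbabilityTheory.beta b (1 / 2))
      -- Inverting turns the possibly singular power `2b - 1` into `1 - 2b > 0`, so the formula
      -- extends continuously to the zeros of `sin Θ`.
      have := HasDerivAt.of_local_left_inverse (g := Θ) hcont.continuousAt hd
        (mul_pos (pi_div_beta_pos hb) (sinDensity_pos _ _)).ne' (Eventually.of_forall hinv)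
      refine this.congr_deriv ?_
      rw [hev.self_of_nhds, mul_inv, inv_div, ← Real.rpow_neg (abs_nonneg _), neg_sub]
  · rw [hinv, phaseTime_neg, hinv]
  · rw [hinv, phaseTime_add_pi hb, hinv]

/-! ### The binary oscillation -/

theorem p₀_eq {α : ℝ} (hα : 1 < α) : p₀ α = (1 + α) ^ (α / (1 - α)) *
    (Real.pi / ProbabilityTheory.beta (1 / (1 + α)) (1 / 2)) ^ ((1 + α) / (1 - α)) := by
  have h1 : 0 < 1 / (1 + α) := by positivity
  have h2 := Real.Gamma_pos_of_pos h1
  have h3 := Real.Gamma_pos_of_pos (show 0 < 1 / (1 + α) + 1 / 2 by positivity)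
  have h4 := Real.sqrt_pos.mpr Real.pi_pos
  have h5 := Real.mul_self_sqrt Real.pi_pos.le
  rw [p₀, ProbabilityTheory.beta, Real.Gamma_one_half_eq]
  congr 2
  rw [div_div_eq_mul_div, div_eq_div_iff h2.ne' (mul_pos h2 h4).ne']
  linear_combination (Real.Gamma (1 / (1 + α) + 1 / 2) * Real.Gamma (1 / (1 + α))) * h5

theorem p₀_pos {α : ℝ} (hα : 1 < α) : 0 < p₀ α := by
  rw [p₀_eq hα]
  exact mul_pos (Real.rpow_pos_of_pos (by linarith) _)
    (Real.rpow_pos_of_pos (pi_div_beta_pos (by positivity)) _)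

/-- The compatibility between slope, amplitude and period: it makes both first-order equations of
the ansatz in `exists_isBinaryProfile` hold with the same phase, and the exponents in `p₀` solve it.
-/
theorem p₀_relation {α : ℝ} (hα : 1 < α) :
    (p₀ α * (1 + α) * (Real.pi / ProbabilityTheory.beta (1 / (1 + α)) (1 / 2))) ^ α =
      p₀ α * (ProbabilityTheory.beta (1 / (1 + α)) (1 / 2) / Real.pi) := by
  have hc : 0 < Real.pi / ProbabilityTheory.beta (1 / (1 + α)) (1 / 2) :=
    pi_div_beta_pos (by positivity)
  have hp := p₀_pos hα
  have h1 : 0 < 1 + α := by linarith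
  rw [← inv_div Real.pi, p₀_eq hα]
  rw [p₀_eq hα] at hp
  set c := Real.pi / ProbabilityTheory.beta (1 / (1 + α)) (1 / 2)
  rw [Real.mul_rpow (by positivity) hc.le, Real.mul_rpow hp.le h1.le,
    Real.mul_rpow (by positivity) (by positivity), ← Real.rpow_mul h1.le, ← Real.rpow_mul hc.le,
    ← Real.rpow_neg_one c]
  have hne : 1 - α ≠ 0 := by linarith
  rw [show (1 + α) ^ (α / (1 - α) * α) * c ^ ((1 + α) / (1 - α) * α) * (1 + α) ^ α * c ^ α =
    ((1 + α) ^ (α / (1 - α) * α) * (1 + α) ^ α) * (c ^ ((1 + α) / (1 - α) * α) * c ^ α) by ring,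
    mul_assoc ((1 + α) ^ (α / (1 - α))), ← Real.rpow_add h1, ← Real.rpow_add hc,
    ← Real.rpow_add hc]
  congr 2 <;> (field_simp; ring)

/-- The odd power function `x ↦ x |x| ^ (p - 1)`. -/
def signedPow (p x : ℝ) : ℝ := posPow p x - posPow p (-x)

theorem continuous_signedPow {p : ℝ} (hp : 0 ≤ p) : Continuous (signedPow p) :=
  (continuous_posPow hp).sub ((continuous_posPow hp).comp continuous_neg)

theorem signedPow_neg (p x : ℝ) : signedPow p (-x) = -signedPow p x := by
  rw [signedPow, signedPow, neg_neg, neg_sub]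

theorem signedPow_of_nonneg {p x : ℝ} (hp : p ≠ 0) (hx : 0 ≤ x) : signedPow p x = x ^ p := by
  rw [signedPow, posPow_of_nonneg hx, posPow_of_nonpos hp (by linarith), sub_zero]

theorem force_eq_signedPow (α x : ℝ) : force α x = 2 ^ α * signedPow α x := rfl

theorem signedPow_mul {p a : ℝ} (ha : 0 ≤ a) (x : ℝ) :
    signedPow p (a * x) = a ^ p * signedPow p x := by
  rw [signedPow, signedPow, ← mul_neg, posPow_mul ha, posPow_mul ha, mul_sub]

theorem signedPow_signedPow {p q : ℝ} (hp : p ≠ 0) (hq : q ≠ 0) (x : ℝ) :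
    signedPow p (signedPow q x) = signedPow (q * p) x := by
  have key : ∀ y : ℝ, 0 ≤ y → signedPow p (signedPow q y) = signedPow (q * p) y := fun y hy => by
    rw [signedPow_of_nonneg hq hy, signedPow_of_nonneg hp (Real.rpow_nonneg hy _),
      signedPow_of_nonneg (mul_ne_zero hq hp) hy, Real.rpow_mul hy]
  rcases le_total 0 x with hx | hx
  · exact key x hx
  · have := key (-x) (by linarith)
    rwa [signedPow_neg, signedPow_neg, signedPow_neg, neg_inj] at this

theorem mul_abs_rpow_eq_signedPow {p : ℝ} (hp : 0 ≤ p) (x : ℝ) :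
    x * |x| ^ p = signedPow (p + 1) x := by
  have key : ∀ y : ℝ, 0 ≤ y → y * |y| ^ p = signedPow (p + 1) y := fun y hy => by
    rw [signedPow_of_nonneg (by linarith) hy, abs_of_nonneg hy,
      Real.rpow_add_one' hy (by linarith), mul_comm]
  rcases le_total 0 x with hx | hx
  · exact key x hx
  · have := key (-x) (by linarith)
    rw [signedPow_neg, abs_neg] at this
    linarith

theorem hasDerivAt_signedPow {p x : ℝ} (hp : p ≠ 0) (hx : x ≠ 0) :
    HasDerivAt (signedPow p) (p * |x| ^ (p - 1)) x := by
  have key : ∀ y : ℝ, 0 < y → HasDerivAt (signedPow p) (p * |y| ^ (p - 1)) y := fun y hy => by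
    rw [abs_of_pos hy]
    refine (Real.hasDerivAt_rpow_const (Or.inl hy.ne')).congr_of_eventuallyEq ?_
    filter_upwards [Ioi_mem_nhds hy] with z hz
    exact signedPow_of_nonneg hp (le_of_lt hz)
  rcases lt_or_gt_of_ne hx with hx | hx
  · have h := ((key (-x) (by linarith)).comp x (hasDerivAt_neg x)).neg
    rw [abs_neg] at h
    refine (h.congr_deriv (by ring)).congr_of_eventuallyEq (Eventually.of_forall fun y => ?_)
    simp [signedPow_neg]
  · exact key x hx

/-- `u` is the binary oscillation, with derivative `u'`. -/
structure IsBinaryProfile (α : ℝ) (u u' : ℝ → ℝ) : Prop where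
  hasDerivAt : ∀ x, HasDerivAt u (u' x) x
  hasDerivAt_deriv : ∀ x, HasDerivAt u' (-force α (u x)) x
  deriv_zero : u' 0 = p₀ α
  odd : ∀ x, u (-x) = -u x
  antiperiodic : ∀ x, u (x + Real.pi) = -u x
  ne_zero : u (Real.pi / 2) ≠ 0

/-- The energy level `u'² / 2 + W(u) = p₀² / 2` is parametrized by an angle: `u' = p₀ cos Θ`, and
`u` is the amplitude `m` times the signed power `2 / (1 + α)` of `sin Θ`. The equation becomes the
phase equation of `exists_phase` with `b = 1 / (1 + α)`. -/
theorem exists_isBinaryProfile {α : ℝ} (hα : 1 < α) : ∃ u u' : ℝ → ℝ, IsBinaryProfile α u u' := by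
  have hb : 0 < 1 / (1 + α) := by positivity
  have hb2 : 1 / (1 + α) < 1 / 2 := one_div_lt_one_div_of_lt two_pos (by linarith)
  obtain ⟨Θ, hΘ, hcount, hodd, hadd⟩ := exists_phase hb hb2
  have hB := ProbabilityTheory.beta_pos hb (β := 1 / 2) (by norm_num)
  have hrel := p₀_relation hα
  have hp := p₀_pos hα
  set B := ProbabilityTheory.beta (1 / (1 + α)) (1 / 2)
  have hpi := Real.pi_pos
  have hα1 : 1 + α ≠ 0 := by linarith
  have hcont : Continuous Θ := continuous_iff_continuousAt.mpr fun x => (hΘ x).continuousAt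
  have hr : 0 < 2 / (1 + α) := by positivity
  -- The amplitude forced by `u' = p₀ cos Θ`; see `hmC`.
  set m : ℝ := p₀ α * (1 + α) * (Real.pi / B) / 2 with hm
  have hmpos : 0 < m := by positivity
  have hmC : m * (2 / (1 + α)) * (B / Real.pi) = p₀ α := by rw [hm]; field_simp
  have hforce : 2 ^ α * m ^ α = p₀ α * (B / Real.pi) := by
    rw [← Real.mul_rpow two_pos.le hmpos.le, ← hrel, hm, mul_div_cancel₀ _ two_ne_zero]
  have hodd0 : Θ 0 = 0 := by have := hodd 0; rw [neg_zero] at this; linarith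
  refine ⟨fun x => m * signedPow (2 / (1 + α)) (Real.sin (Θ x)),
    fun x => p₀ α * Real.cos (Θ x), ⟨?_, fun x => ?_, by simp [hodd0], fun x => ?_, fun x => ?_, ?_⟩⟩
  -- The exponent `2 / (1 + α)` is below `1`, so the signed power is not differentiable at `0`; the
  -- zeros of `sin Θ` are the exceptional set.
  · refine hasDerivAt_of_hasDerivAt_off_countable (continuous_const.mul
      ((continuous_signedPow hr.le).comp (Real.continuous_sin.comp hcont)))
      (continuous_const.mul (Real.continuous_cos.comp hcont)) hcount fun x hx => ?_
    have hx : Real.sin (Θ x) ≠ 0 := hx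
    have h := ((hasDerivAt_signedPow hr.ne' hx).comp x ((hΘ x).sin)).const_mul m
    refine h.congr_deriv ?_
    have e : |Real.sin (Θ x)| ^ (2 / (1 + α) - 1) * |Real.sin (Θ x)| ^ (1 - 2 * (1 / (1 + α))) =
        1 := by
      rw [← Real.rpow_add (abs_pos.mpr hx),
        show 2 / (1 + α) - 1 + (1 - 2 * (1 / (1 + α))) = 0 by ring, Real.rpow_zero]
    rw [← hmC]
    linear_combination (m * (2 / (1 + α)) * Real.cos (Θ x) * (B / Real.pi)) * e
  · have h := ((hΘ x).cos).const_mul (p₀ α)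
    refine h.congr_deriv ?_
    have e := mul_abs_rpow_eq_signedPow (p := 1 - 2 * (1 / (1 + α))) (by linarith) (Real.sin (Θ x))
    rw [force_eq_signedPow, signedPow_mul hmpos.le, signedPow_signedPow (by linarith) hr.ne',
      ← mul_assoc (2 ^ α), hforce, show 2 / (1 + α) * α = 1 - 2 * (1 / (1 + α)) + 1 by field_simp; ring,
      ← e]
    ring
  · simp only [hodd, Real.sin_neg, signedPow_neg, mul_neg]
  · simp only [hadd, Real.sin_add_pi, signedPow_neg, mul_neg]
  · have h := hadd (-(Real.pi / 2))
    rw [hodd, show -(Real.pi / 2) + Real.pi = Real.pi / 2 by ring] at h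
    have h' : Θ (Real.pi / 2) = Real.pi / 2 := by linarith
    simp only [h', Real.sin_pi_div_two, signedPow_of_nonneg hr.ne' zero_le_one, Real.one_rpow]
    simpa using hmpos.ne'

namespace IsBinaryProfile

variable {α : ℝ} {u u' : ℝ → ℝ}

theorem apply_zero (h : IsBinaryProfile α u u') : u 0 = 0 := by
  have := h.odd 0
  rw [neg_zero] at this
  linarith

theorem periodic (h : IsBinaryProfile α u u') : Function.Periodic u (2 * Real.pi) := fun x => by
  rw [two_mul, ← add_assoc, h.antiperiodic, h.antiperiodic, neg_neg]

theorem continuous (h : IsBinaryProfile α u u') : Continuous u :=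
  continuous_iff_continuousAt.mpr fun x => (h.hasDerivAt x).continuousAt

theorem continuous_deriv (h : IsBinaryProfile α u u') : Continuous u' :=
  continuous_iff_continuousAt.mpr fun x => (h.hasDerivAt_deriv x).continuousAt

theorem deriv_neg (h : IsBinaryProfile α u u') (x : ℝ) : u' (-x) = u' x :=
  deriv_even_of_hasDerivAt h.hasDerivAt h.odd x

theorem deriv_antiperiodic (h : IsBinaryProfile α u u') (x : ℝ) : u' (x + Real.pi) = -u' x :=
  deriv_antiperiodic_of_hasDerivAt h.hasDerivAt h.antiperiodic x

end IsBinaryProfile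

theorem continuous_force {α : ℝ} (hα : 1 < α) : Continuous (force α) :=
  continuous_iff_continuousAt.mpr fun x => (hasDerivAt_force hα x).continuousAt

theorem contDiff_force {α : ℝ} (hα : 1 < α) : ContDiff ℝ 1 (force α) := by
  rw [contDiff_one_iff_deriv, funext fun x => (hasDerivAt_force hα x).deriv]
  exact ⟨fun x => (hasDerivAt_force hα x).differentiableAt, continuous_stiffness hα⟩

/-- Uniqueness for the initial value problem `u'' + W'(u) = 0`. -/
theorem eq_of_force_ode {α : ℝ} (hα : 1 < α) {u u' v v' : ℝ → ℝ}
    (hu : ∀ x, HasDerivAt u (u' x) x) (hu' : ∀ x, HasDerivAt u' (-force α (u x)) x)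
    (hv : ∀ x, HasDerivAt v (v' x) x) (hv' : ∀ x, HasDerivAt v' (-force α (v x)) x)
    (h0 : u 0 = v 0) (h1 : u' 0 = v' 0) : u = v := by
  have hcu : Continuous fun x => (u x, u' x) := continuous_iff_continuousAt.mpr fun x =>
    (hu x).continuousAt.prodMk (hu' x).continuousAt
  have hcv : Continuous fun x => (v x, v' x) := continuous_iff_continuousAt.mpr fun x =>
    (hv x).continuousAt.prodMk (hv' x).continuousAt
  funext x
  set R := |x| + 1
  have hR : 0 < R := by positivity
  obtain ⟨M, hM⟩ := ((isCompact_Icc (a := -R) (b := R)).image hcu).isBounded.subset_closedBall 0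
  obtain ⟨N, hN⟩ := ((isCompact_Icc (a := -R) (b := R)).image hcv).isBounded.subset_closedBall 0
  -- A ball containing both orbits over a compact interval, on which the vector field is Lipschitz.
  set s : Set (ℝ × ℝ) := Metric.closedBall 0 (max M N)
  have hF : ContDiff ℝ 1 fun z : ℝ × ℝ => (z.2, -force α z.1) :=
    contDiff_snd.prodMk ((contDiff_force hα).comp contDiff_fst).neg
  obtain ⟨K, hK⟩ := hF.contDiffOn.exists_lipschitzOnWith one_ne_zero
    (convex_closedBall 0 (max M N)) (isCompact_closedBall (0 : ℝ × ℝ) (max M N))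
  have hxR : x ∈ Ioo (-R) R :=
    ⟨by linarith [neg_abs_le x], by linarith [le_abs_self x]⟩
  have key := ODE_solution_unique_of_mem_Ioo (v := fun _ z => (z.2, -force α z.1))
    (s := fun _ => s) (K := K) (a := -R) (b := R) (t₀ := 0)
    (f := fun x => (u x, u' x)) (g := fun x => (v x, v' x))
    (fun _ _ => hK) ⟨by linarith, hR⟩
    (fun t ht => ⟨(hu t).prodMk (hu' t), Metric.closedBall_subset_closedBall (le_max_left M N)
      (hM ⟨t, Ioo_subset_Icc_self ht, rfl⟩)⟩)
    (fun t ht => ⟨(hv t).prodMk (hv' t), Metric.closedBall_subset_closedBall (le_max_right M N)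
      (hN ⟨t, Ioo_subset_Icc_self ht, rfl⟩)⟩)
    (by simp [h0, h1]) hxR
  exact congrArg Prod.fst key

theorem IsBinaryProfile.isBinaryOscillation_iff {α : ℝ} (hα : 1 < α) {u u' : ℝ → ℝ}
    (h : IsBinaryProfile α u u') (v : ℝ → ℝ) : IsBinaryOscillation α v ↔ v = u := by
  constructor
  · rintro ⟨hv, hode, h0, h1⟩
    have hd : ∀ x, HasDerivAt v (deriv v x) x := fun x =>
      (hv.differentiable (by norm_num) x).hasDerivAt
    have hd' : ∀ x, HasDerivAt (deriv v) (-force α (v x)) x := fun x => by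
      have h2 := (hv.differentiable_deriv_two x).hasDerivAt
      refine h2.congr_deriv ?_
      have := hode x
      rw [iteratedDeriv_succ, iteratedDeriv_one, deriv_W hα] at this
      linarith
    exact eq_of_force_ode hα hd hd' h.hasDerivAt h.hasDerivAt_deriv (by rw [h0, h.apply_zero])
      (by rw [h1, h.deriv_zero])
  · rintro rfl
    refine ⟨contDiff_two_of_hasDerivAt h.hasDerivAt h.hasDerivAt_deriv
      ((continuous_force hα).comp h.continuous).neg, fun x => ?_, h.apply_zero, ?_⟩
    · rw [iteratedDeriv_two_eq_of_hasDerivAt h.hasDerivAt h.hasDerivAt_deriv, deriv_W hα]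
      ring
    · rw [(h.hasDerivAt 0).deriv, h.deriv_zero]

/-! ### The linearization at the binary oscillation -/

theorem wronskian_const {k y y' w w' : ℝ → ℝ} (hy : ∀ x, HasDerivAt y (y' x) x)
    (hy' : ∀ x, HasDerivAt y' (-(k x * y x)) x) (hw : ∀ x, HasDerivAt w (w' x) x)
    (hw' : ∀ x, HasDerivAt w' (-(k x * w x)) x) (a b : ℝ) :
    y a * w' a - y' a * w a = y b * w' b - y' b * w b := by
  have h : ∀ x, HasDerivAt (fun x => y x * w' x - y' x * w x) 0 x := fun x => by
    refine (((hy x).mul (hw' x)).sub ((hy' x).mul (hw x))).congr_deriv ?_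
    ring
  exact is_const_of_deriv_eq_zero (fun x => (h x).differentiableAt) (fun x => (h x).deriv) a b

namespace IsBinaryProfile

variable {α : ℝ} {u u' : ℝ → ℝ}

/-- The second, scaling-generated solution of the linearized equation. -/
def scalingMode (α : ℝ) (u u' : ℝ → ℝ) (x : ℝ) : ℝ := u x + (α - 1) / 2 * (x * u' x)

/-- The derivative of `scalingMode`. -/
def scalingModeDeriv (α : ℝ) (u u' : ℝ → ℝ) (x : ℝ) : ℝ :=
  u' x + (α - 1) / 2 * (u' x + x * -force α (u x))

theorem hasDerivAt_scalingMode (h : IsBinaryProfile α u u') (x : ℝ) :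
    HasDerivAt (scalingMode α u u') (scalingModeDeriv α u u' x) x := by
  have := (h.hasDerivAt x).add
    (((hasDerivAt_id x).mul (h.hasDerivAt_deriv x)).const_mul ((α - 1) / 2))
  rw [one_mul] at this
  exact this

theorem hasDerivAt_force_comp (h : IsBinaryProfile α u u') (hα : 1 < α) (x : ℝ) :
    HasDerivAt (fun x => -force α (u x)) (-(stiffness α (u x) * u' x)) x :=
  ((hasDerivAt_force hα (u x)).comp x (h.hasDerivAt x)).neg

/-- `λ u(λ^((α-1)/2) x)` solves the nonlinear equation for every `λ > 0`; `scalingMode` is its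
derivative in `λ` at `1`. -/
theorem hasDerivAt_scalingModeDeriv (h : IsBinaryProfile α u u') (hα : 1 < α) (x : ℝ) :
    HasDerivAt (scalingModeDeriv α u u') (-(stiffness α (u x) * scalingMode α u u' x)) x := by
  have := (h.hasDerivAt_deriv x).add (((h.hasDerivAt_deriv x).add
    ((hasDerivAt_id x).mul (h.hasDerivAt_force_comp hα x))).const_mul ((α - 1) / 2))
  refine this.congr_deriv ?_
  have e := stiffness_mul_self hα (u x)
  rw [scalingMode]
  simp only [id]
  linear_combination e

theorem deriv_pi_div_two (h : IsBinaryProfile α u u') : u' (Real.pi / 2) = 0 := by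
  have := h.deriv_antiperiodic (-(Real.pi / 2))
  rw [h.deriv_neg, show -(Real.pi / 2) + Real.pi = Real.pi / 2 by ring] at this
  linarith

theorem scalingMode_neg (h : IsBinaryProfile α u u') (x : ℝ) :
    scalingMode α u u' (-x) = -scalingMode α u u' x := by
  rw [scalingMode, scalingMode, h.odd, h.deriv_neg]; ring

/-- The nondegeneracy of the problem: since `u'(π/2) = 0`, only the term produced by the amplitude
dependence of the period survives, and it carries the factor `α - 1`. -/
theorem scalingModeDeriv_pi_div_two_ne_zero (h : IsBinaryProfile α u u') (hα : 1 < α) :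
    scalingModeDeriv α u u' (Real.pi / 2) ≠ 0 := by
  have hpi := Real.pi_pos
  have hf : force α (u (Real.pi / 2)) ≠ 0 := by
    intro h0
    have := stiffness_mul_self hα (u (Real.pi / 2))
    rw [h0, mul_zero, stiffness] at this
    have h1 : 0 < |u (Real.pi / 2)| ^ (α - 1) := Real.rpow_pos_of_pos (abs_pos.mpr h.ne_zero) _
    have h2 : (0 : ℝ) < 2 ^ α := Real.rpow_pos_of_pos two_pos _
    exact mul_ne_zero (by positivity) h.ne_zero this
  rw [scalingModeDeriv, h.deriv_pi_div_two, zero_add, zero_add]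
  have h1 : (α - 1) / 2 ≠ 0 := by linarith
  exact mul_ne_zero h1 (mul_ne_zero (by positivity) (neg_ne_zero.mpr hf))

/-- The (constant) Wronskian of the two solutions of the linearized equation. -/
def modeWronskian (α : ℝ) : ℝ := (1 + (α - 1) / 2) * p₀ α ^ 2

theorem modeWronskian_ne_zero (hα : 1 < α) : modeWronskian α ≠ 0 := by
  have := p₀_pos hα
  have h1 : 0 < 1 + (α - 1) / 2 := by linarith
  exact (mul_pos h1 (by positivity)).ne'

theorem wronskian_eq (h : IsBinaryProfile α u u') (hα : 1 < α) (x : ℝ) :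
    u' x * scalingModeDeriv α u u' x - -force α (u x) * scalingMode α u u' x =
      modeWronskian α := by
  rw [wronskian_const (k := fun x => stiffness α (u x)) (y := u') (y' := fun x => -force α (u x))
    (w := scalingMode α u u') (w' := scalingModeDeriv α u u') h.hasDerivAt_deriv
    (h.hasDerivAt_force_comp hα) h.hasDerivAt_scalingMode (h.hasDerivAt_scalingModeDeriv hα) x 0,
    scalingMode, scalingModeDeriv, h.apply_zero, h.deriv_zero, modeWronskian]
  ring

/-- The Wronskians of `w` with two independent solutions vanish at `c`, hence everywhere, and
Cramer's rule gives `w = 0`. -/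
theorem eq_zero_of_linearized (h : IsBinaryProfile α u u') (hα : 1 < α) {w w' : ℝ → ℝ}
    (hw : ∀ x, HasDerivAt w (w' x) x) (hw' : ∀ x, HasDerivAt w' (-(stiffness α (u x) * w x)) x)
    {c : ℝ} (h0 : w c = 0) (h1 : w' c = 0) (x : ℝ) : w x = 0 := by
  have e1 := wronskian_const (k := fun x => stiffness α (u x)) h.hasDerivAt_deriv
    (h.hasDerivAt_force_comp hα) hw hw' x c
  have e2 := wronskian_const (k := fun x => stiffness α (u x)) h.hasDerivAt_scalingMode
    (h.hasDerivAt_scalingModeDeriv hα) hw hw' x c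
  rw [h0, h1, mul_zero, mul_zero, sub_zero] at e1 e2
  have e3 := h.wronskian_eq hα x
  refine (mul_eq_zero.mp (?_ : w x * modeWronskian α = 0)).resolve_right
    (modeWronskian_ne_zero hα)
  rw [← e3]
  linear_combination scalingMode α u u' x * e1 - u' x * e2

/-- Symmetry gives `w 0 = 0` and `w' (π/2) = 0`. The Wronskian with `scalingMode` vanishes at `0`,
and at `π/2` it reduces to a nonzero multiple of `w (π/2)`, so the Cauchy data at `π/2` are zero. -/
theorem eq_zero_of_linearized_of_odd_antiperiodic (h : IsBinaryProfile α u u') (hα : 1 < α)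
    {w w' : ℝ → ℝ} (hw : ∀ x, HasDerivAt w (w' x) x)
    (hw' : ∀ x, HasDerivAt w' (-(stiffness α (u x) * w x)) x)
    (hodd : ∀ x, w (-x) = -w x) (hanti : ∀ x, w (x + Real.pi) = -w x) (x : ℝ) : w x = 0 := by
  have hd : w' (Real.pi / 2) = 0 := by
    have h1 := deriv_antiperiodic_of_hasDerivAt hw hanti (-(Real.pi / 2))
    rw [deriv_even_of_hasDerivAt hw hodd,
      show -(Real.pi / 2) + Real.pi = Real.pi / 2 by ring] at h1
    linarith
  have h0 : w 0 = 0 := by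
    have := hodd 0
    rw [neg_zero] at this
    linarith
  have e := wronskian_const (k := fun x => stiffness α (u x)) h.hasDerivAt_scalingMode
    (h.hasDerivAt_scalingModeDeriv hα) hw hw' (Real.pi / 2) 0
  have hs : scalingMode α u u' 0 = 0 := by simp [scalingMode, h.apply_zero]
  rw [hd, h0, hs, zero_mul, mul_zero, mul_zero, sub_zero, zero_sub, neg_eq_zero] at e
  exact h.eq_zero_of_linearized hα hw hw'
    ((mul_eq_zero.mp e).resolve_left (h.scalingModeDeriv_pi_div_two_ne_zero hα)) hd x

theorem stiffness_add_pi (h : IsBinaryProfile α u u') (x : ℝ) :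
    stiffness α (u (x + Real.pi)) = stiffness α (u x) := by
  rw [h.antiperiodic, stiffness, stiffness, abs_neg]

theorem stiffness_neg (h : IsBinaryProfile α u u') (x : ℝ) :
    stiffness α (u (-x)) = stiffness α (u x) := by
  rw [h.odd, stiffness, stiffness, abs_neg]

theorem hasDerivAt_integral_of_continuous {f : ℝ → ℝ} (hf : Continuous f) (x : ℝ) :
    HasDerivAt (fun x => ∫ s in (0)..x, f s) (f x) x :=
  intervalIntegral.integral_hasDerivAt_right (hf.intervalIntegrable _ _)
    (hf.stronglyMeasurableAtFilter _ _) hf.continuousAt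

/-- Solvability of the inhomogeneous linearized equation among odd antiperiodic functions. -/
theorem exists_linearized_eq (h : IsBinaryProfile α u u') (hα : 1 < α) {g : ℝ → ℝ}
    (hg : Continuous g) (godd : ∀ x, g (-x) = -g x) (ganti : ∀ x, g (x + Real.pi) = -g x) :
    ∃ z z' : ℝ → ℝ, (∀ x, HasDerivAt z (z' x) x) ∧
      (∀ x, HasDerivAt z' (g x - stiffness α (u x) * z x) x) ∧
      (∀ x, z (-x) = -z x) ∧ ∀ x, z (x + Real.pi) = -z x := by
  have hc2 : Continuous (scalingMode α u u') :=
    continuous_iff_continuousAt.mpr fun x => (h.hasDerivAt_scalingMode x).continuousAt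
  set I₁ : ℝ → ℝ := fun x => ∫ s in (0)..x, u' s * g s
  set I₂ : ℝ → ℝ := fun x => ∫ s in (0)..x, scalingMode α u u' s * g s
  have hI₁ : ∀ x, HasDerivAt I₁ (u' x * g x) x :=
    hasDerivAt_integral_of_continuous (h.continuous_deriv.mul hg)
  have hI₂ : ∀ x, HasDerivAt I₂ (scalingMode α u u' x * g x) x :=
    hasDerivAt_integral_of_continuous (hc2.mul hg)
  have I₁_even : ∀ x, I₁ (-x) = I₁ x :=
    even_of_hasDerivAt hI₁ fun x => by rw [h.deriv_neg, godd, mul_neg]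
  have I₂_odd : ∀ x, I₂ (-x) = -I₂ x :=
    odd_of_hasDerivAt hI₂ (fun x => by rw [h.scalingMode_neg, godd, neg_mul_neg])
      intervalIntegral.integral_same
  set ω := modeWronskian α
  have hω : ω ≠ 0 := modeWronskian_ne_zero hα
  -- Variation of constants; the parities of `I₁` and `I₂` make it odd.
  set zp : ℝ → ℝ := fun x => ω⁻¹ * (scalingMode α u u' x * I₁ x - u' x * I₂ x)
  set zp' : ℝ → ℝ := fun x => ω⁻¹ * (scalingModeDeriv α u u' x * I₁ x - -force α (u x) * I₂ x)
  have hzp : ∀ x, HasDerivAt zp (zp' x) x := fun x => by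
    refine ((((h.hasDerivAt_scalingMode x).mul (hI₁ x)).sub
      ((h.hasDerivAt_deriv x).mul (hI₂ x))).const_mul ω⁻¹).congr_deriv ?_
    simp only [zp']
    ring
  have hzp' : ∀ x, HasDerivAt zp' (g x - stiffness α (u x) * zp x) x := fun x => by
    refine ((((h.hasDerivAt_scalingModeDeriv hα x).mul (hI₁ x)).sub
      ((h.hasDerivAt_force_comp hα x).mul (hI₂ x))).const_mul ω⁻¹).congr_deriv ?_
    have e : ω⁻¹ * modeWronskian α = 1 := inv_mul_cancel₀ hω
    rw [← h.wronskian_eq hα x] at e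
    simp only [zp]
    linear_combination (g x) * e
  -- Adding this multiple of the odd homogeneous solution achieves `z' (π/2) = 0`.
  set c : ℝ := -zp' (Real.pi / 2) / scalingModeDeriv α u u' (Real.pi / 2)
  set z : ℝ → ℝ := fun x => zp x + c * scalingMode α u u' x
  set z' : ℝ → ℝ := fun x => zp' x + c * scalingModeDeriv α u u' x
  have hz : ∀ x, HasDerivAt z (z' x) x := fun x =>
    (hzp x).add ((h.hasDerivAt_scalingMode x).const_mul c)
  have hz' : ∀ x, HasDerivAt z' (g x - stiffness α (u x) * z x) x := fun x => by
    refine ((hzp' x).add ((h.hasDerivAt_scalingModeDeriv hα x).const_mul c)).congr_deriv ?_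
    simp only [z]
    ring
  have zodd : ∀ x, z (-x) = -z x := fun x => by
    simp only [z, zp, h.scalingMode_neg, I₁_even, I₂_odd, h.deriv_neg]
    ring
  have hzpi : z' (Real.pi / 2) = 0 := by
    simp only [z', c]
    rw [div_mul_cancel₀ _ (h.scalingModeDeriv_pi_div_two_ne_zero hα), add_neg_cancel]
  refine ⟨z, z', hz, hz', zodd, fun x => ?_⟩
  have hpi2 : -(Real.pi / 2) + Real.pi = Real.pi / 2 := by ring
  -- The defect of antiperiodicity solves the homogeneous equation and has zero Cauchy data at
  -- `-π/2`, by oddness of `z` and `z' (π/2) = 0`.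
  have key := h.eq_zero_of_linearized hα (w := fun x => z (x + Real.pi) + z x)
    (w' := fun x => z' (x + Real.pi) + z' x) (c := -(Real.pi / 2))
    (fun x => ((hz (x + Real.pi)).comp_add_const x Real.pi).add (hz x))
    (fun x => by
      refine (((hz' (x + Real.pi)).comp_add_const x Real.pi).add (hz' x)).congr_deriv ?_
      rw [h.stiffness_add_pi, ganti]
      ring)
    (by simp only [hpi2, zodd]; ring)
    (by simp only [hpi2, deriv_even_of_hasDerivAt hz zodd, hzpi, add_zero]) x
  linarith

/-- The acceleration of the binary oscillation, as a function on the circle. -/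
def accel (h : IsBinaryProfile α u u') (hα : 1 < α) : C(Circ, ℝ) :=
  toCirc (fun x => -force α (u x)) ((continuous_force hα).comp h.continuous).neg
    fun x => by simp only [h.periodic x]

/-- The stiffness along the binary oscillation, as a function on the circle. -/
def stiffnessC (h : IsBinaryProfile α u u') (hα : 1 < α) : C(Circ, ℝ) :=
  toCirc (fun x => stiffness α (u x)) ((continuous_stiffness hα).comp h.continuous)
    fun x => by simp only [h.periodic x]

theorem sol_accel (h : IsBinaryProfile α u u') (hα : 1 < α) : sol (h.accel hα) = u := by
  refine (sol_unique h.hasDerivAt (fun x => ?_) h.apply_zero ?_).symm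
  · rw [oddPart_eq_self]
    · exact h.hasDerivAt_deriv x
    · intro y
      change -force α (u (-y)) = - -force α (u y)
      rw [h.odd, force_neg]
  · have := h.periodic 0
    rwa [zero_add, h.apply_zero] at this

end IsBinaryProfile

theorem sol_pi (f : C(Circ, ℝ)) : sol f Real.pi = 0 := by
  have := periodic_sol f (-Real.pi)
  rw [sol_neg, show -Real.pi + 2 * Real.pi = Real.pi by ring] at this
  linarith

theorem sol_add_two_pi (f : C(Circ, ℝ)) (x : ℝ) : sol f (x + Real.pi + Real.pi) = sol f x := by
  rw [add_assoc, ← two_mul, periodic_sol f x]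

theorem sol_neg_add_pi (f : C(Circ, ℝ)) (x : ℝ) : sol f (-x + Real.pi) = -sol f (x + Real.pi) := by
  rw [← sol_neg, ← periodic_sol f (-(x + Real.pi))]
  congr 1; ring

theorem oddPart_add_two_pi (f : C(Circ, ℝ)) (x : ℝ) :
    oddPart f (x + Real.pi + Real.pi) = oddPart f x := by
  rw [add_assoc, ← two_mul, periodic_oddPart f x]

theorem oddPart_neg_add_pi (f : C(Circ, ℝ)) (x : ℝ) :
    oddPart f (-x + Real.pi) = -oddPart f (x + Real.pi) := by
  rw [← oddPart_neg, ← periodic_oddPart f (-(x + Real.pi))]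
  congr 1; ring

/-! ### Bijectivity of the linearized operator -/

namespace IsBinaryProfile

variable {α : ℝ} {u u' : ℝ → ℝ}

/-- The linearized operator at the binary oscillation, acting on accelerations. -/
def linOp (h : IsBinaryProfile α u u') (hα : 1 < α) : C(Circ, ℝ) →L[ℝ] C(Circ, ℝ) :=
  ContinuousLinearMap.id ℝ _ + (1 / 2 : ℝ) • (ContinuousLinearMap.mul ℝ C(Circ, ℝ)
    (h.stiffnessC hα)) ∘L (solL - shift Real.pi ∘L solL)

theorem linOp_coe (h : IsBinaryProfile α u u') (hα : 1 < α) (v : C(Circ, ℝ)) (x : ℝ) :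
    h.linOp hα v (x : Circ) =
      v (x : Circ) + 1 / 2 * (stiffness α (u x) * (sol v x - sol v (x + Real.pi))) := rfl

/-- A kernel element is automatically odd. The antiperiodic part of `sol v` solves the homogeneous
Hill equation, hence vanishes, and `v` is a multiple of it by the equation. -/
theorem linOp_injective (h : IsBinaryProfile α u u') (hα : 1 < α) :
    Function.Injective (h.linOp hα) := by
  rw [injective_iff_map_eq_zero]
  intro v hv
  have hv' : ∀ x : ℝ, v (x : Circ) =
      -(1 / 2 * (stiffness α (u x) * (sol v x - sol v (x + Real.pi)))) := fun x => by
    have := h.linOp_coe hα v x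
    rw [hv, ContinuousMap.zero_apply] at this
    linarith
  have hodd : ∀ x, oddPart v x = v (x : Circ) := oddPart_eq_self fun x => by
    rw [hv', hv', h.stiffness_neg, sol_neg, sol_neg_add_pi]
    ring
  have hw := h.eq_zero_of_linearized_of_odd_antiperiodic hα
    (w := fun x => (sol v x - sol v (x + Real.pi)) / 2)
    (w' := fun x => (slope v x - slope v (x + Real.pi)) / 2)
    (fun x => ((hasDerivAt_sol v x).sub
      ((hasDerivAt_sol v _).comp_add_const x Real.pi)).div_const 2)
    (fun x => by
      refine (((hasDerivAt_slope v x).sub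
        ((hasDerivAt_slope v _).comp_add_const x Real.pi)).div_const 2).congr_deriv ?_
      rw [hodd, hodd, hv', hv', h.stiffness_add_pi, sol_add_two_pi]
      ring)
    (fun x => by rw [sol_neg, sol_neg_add_pi]; ring)
    (fun x => by rw [sol_add_two_pi]; ring)
  refine circ_ext fun x => ?_
  have := hw x
  rw [hv', ContinuousMap.zero_apply]
  linear_combination (-stiffness α (u x)) * this

/-- Only the antiperiodic part `z` of `sol v` enters, so solve the Hill equation for `z` first and
set `v = g - stiffness * z`; that `z` is indeed the antiperiodic part of `sol v` follows by
comparing second derivatives. -/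
theorem linOp_surjective (h : IsBinaryProfile α u u') (hα : 1 < α) :
    Function.Surjective (h.linOp hα) := by
  intro g
  obtain ⟨z, z', hz, hz', zodd, zanti⟩ := h.exists_linearized_eq hα
    (g := fun x => (oddPart g x - oddPart g (x + Real.pi)) / 2)
    (((continuous_oddPart g).sub
      ((continuous_oddPart g).comp (continuous_add_const Real.pi))).div_const 2)
    (fun x => by rw [oddPart_neg, oddPart_neg_add_pi]; ring)
    (fun x => by rw [oddPart_add_two_pi]; ring)
  have hzc : Continuous z := continuous_iff_continuousAt.mpr fun x => (hz x).continuousAt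
  have hzper : Function.Periodic z (2 * Real.pi) := fun x => by
    rw [two_mul, ← add_assoc, zanti, zanti, neg_neg]
  set kz : C(Circ, ℝ) := toCirc (fun x => stiffness α (u x) * z x)
    (((continuous_stiffness hα).comp h.continuous).mul hzc) fun x => by
      dsimp only
      rw [h.periodic, hzper]
  have hkz : ∀ x : ℝ, kz (x : Circ) = stiffness α (u x) * z x := fun x => rfl
  have hov : ∀ x, oddPart (g - kz) x = oddPart g x - stiffness α (u x) * z x := fun x => by
    simp only [oddPart, ContinuousMap.sub_apply, hkz, h.stiffness_neg, zodd]
    ring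
  have key : (fun x => (sol (g - kz) x - sol (g - kz) (x + Real.pi)) / 2) = z := by
    have h0 : z 0 = 0 := by
      have := zodd 0
      rw [neg_zero] at this
      linarith
    have hs := periodic_sol (g - kz) 0
    have hs' := periodic_sol (g - kz) Real.pi
    rw [zero_add, sol_zero] at hs
    rw [add_comm, sol_pi] at hs'
    refine eq_of_second_deriv_eq
      (w' := fun x => (slope (g - kz) x - slope (g - kz) (x + Real.pi)) / 2)
      (fun x => ((hasDerivAt_sol _ x).sub
        ((hasDerivAt_sol _ _).comp_add_const x Real.pi)).div_const 2)
      (fun x => ?_) hz hz' ?_ h0 ?_ ?_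
    · refine (((hasDerivAt_slope _ x).sub
        ((hasDerivAt_slope _ _).comp_add_const x Real.pi)).div_const 2).congr_deriv ?_
      rw [hov, hov, h.stiffness_add_pi, zanti]
      ring
    · simp only [zero_add, sol_zero, sol_pi, sub_zero, zero_div]
    · simp only [hs, hs', sub_zero, zero_div]
    · have := hzper 0
      rwa [zero_add, h0] at this
  refine ⟨g - kz, circ_ext fun x => ?_⟩
  rw [h.linOp_coe, ContinuousMap.sub_apply, hkz]
  have := congrFun key x
  linear_combination stiffness α (u x) * this

end IsBinaryProfile

/-! ### The advance-delay equation as an equation for the acceleration -/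

/-- The truncated power as a bundled continuous function. -/
def posPowC {p : ℝ} (hp : 0 ≤ p) : C(ℝ, ℝ) := ⟨posPow p, continuous_posPow hp⟩

theorem contDiff_posPowC_comp {α : ℝ} (hα : 1 < α) :
    ContDiff ℝ 1 fun w : C(Circ, ℝ) => (posPowC (p := α) (by linarith)).comp w :=
  contDiff_superposition (φ' := α • posPowC (p := α - 1) (by linarith))
    fun x => hasDerivAt_posPow hα x

/-- The residual of the advance-delay equation with wavenumber `π + μ` for the profile `sol f`. -/
def residual {α : ℝ} (hα : 1 < α) (z : ℝ × C(Circ, ℝ)) : C(Circ, ℝ) :=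
  z.2 + (posPowC (p := α) (by linarith)).comp
      (solL z.2 - (shift (Real.pi + z.1) ∘L solL) z.2) -
    (posPowC (p := α) (by linarith)).comp
      ((shift (-(Real.pi + z.1)) ∘L solL) z.2 - solL z.2)

theorem residual_coe {α : ℝ} (hα : 1 < α) (μ : ℝ) (f : C(Circ, ℝ)) (x : ℝ) :
    residual hα (μ, f) (x : Circ) = f (x : Circ) +
      posPow α (sol f x - sol f (x + (Real.pi + μ))) -
      posPow α (sol f (x + -(Real.pi + μ)) - sol f x) := rfl

theorem contDiff_residual {α : ℝ} (hα : 1 < α) : ContDiff ℝ 1 (residual hα) := by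
  have h1 : ContDiff ℝ 1 fun z : ℝ × C(Circ, ℝ) => (shift (Real.pi + z.1) ∘L solL) z.2 :=
    (contDiff_shift_comp_solL.comp (contDiff_const.add contDiff_fst)).clm_apply contDiff_snd
  have h2 : ContDiff ℝ 1 fun z : ℝ × C(Circ, ℝ) => (shift (-(Real.pi + z.1)) ∘L solL) z.2 :=
    (contDiff_shift_comp_solL.comp (contDiff_const.add contDiff_fst).neg).clm_apply contDiff_snd
  have h3 : ContDiff ℝ 1 fun z : ℝ × C(Circ, ℝ) => solL z.2 := solL.contDiff.comp contDiff_snd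
  exact (contDiff_snd.add ((contDiff_posPowC_comp hα).comp (h3.sub h1))).sub
    ((contDiff_posPowC_comp hα).comp (h2.sub h3))

/-- Translations by `π` and `-π` agree on `2π`-periodic functions, so a single linear operator
enters both contact terms. -/
theorem residual_zero_eq {α : ℝ} (hα : 1 < α) (f : C(Circ, ℝ)) :
    residual hα (0, f) = f +
      (posPowC (p := α) (by linarith)).comp ((solL - shift Real.pi ∘L solL) f) -
      (posPowC (p := α) (by linarith)).comp (-(solL - shift Real.pi ∘L solL) f) := by
  refine circ_ext fun x => ?_
  rw [residual_coe]
  change _ = f (x : Circ) + posPow α (sol f x - sol f (x + Real.pi)) -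
    posPow α (-(sol f x - sol f (x + Real.pi)))
  rw [add_zero, neg_sub, ← periodic_sol f (x + -Real.pi)]
  congr 4
  ring

theorem hasFDerivAt_posPowC_comp {α : ℝ} (hα : 1 < α) (w : C(Circ, ℝ)) :
    HasFDerivAt (fun w : C(Circ, ℝ) => (posPowC (p := α) (by linarith)).comp w)
      (ContinuousLinearMap.mul ℝ C(Circ, ℝ)
        ((α • posPowC (p := α - 1) (by linarith)).comp w)) w :=
  hasFDerivAt_superposition (φ' := α • posPowC (p := α - 1) (by linarith))
    (fun x => hasDerivAt_posPow hα x) w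

theorem IsBinaryProfile.residual_accel {α : ℝ} {u u' : ℝ → ℝ} (h : IsBinaryProfile α u u')
    (hα : 1 < α) : residual hα (0, h.accel hα) = 0 := by
  refine circ_ext fun x => ?_
  rw [residual_coe, h.sol_accel hα, add_zero]
  have e : u (x + -Real.pi) = -u x := by
    rw [← neg_eq_iff_eq_neg, ← h.antiperiodic]; congr 1; ring
  change -force α (u x) + _ - _ = 0
  rw [h.antiperiodic, e, force,
    show u x - -u x = 2 * u x by ring, show -u x - u x = 2 * -u x by ring,
    posPow_mul two_pos.le, posPow_mul two_pos.le]
  ring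

/-- The two truncated powers recombine into `|2u|^(α-1)`, and `2^(α-1) = 2^α / 2` gives the factor
`1/2` of `linOp`. -/
theorem IsBinaryProfile.hasFDerivAt_residual {α : ℝ} {u u' : ℝ → ℝ}
    (h : IsBinaryProfile α u u') (hα : 1 < α) :
    HasFDerivAt (fun f => residual hα (0, f)) (h.linOp hα) (h.accel hα) := by
  set T : C(Circ, ℝ) →L[ℝ] C(Circ, ℝ) := solL - shift Real.pi ∘L solL with hT
  have e : (fun f => residual hα (0, f)) = fun f => f +
      (posPowC (p := α) (by linarith)).comp (T f) -
      (posPowC (p := α) (by linarith)).comp ((-T) f) := funext fun f => residual_zero_eq hα f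
  rw [e]
  have h1 := (hasFDerivAt_posPowC_comp hα (T (h.accel hα))).comp (h.accel hα) T.hasFDerivAt
  have h2 := (hasFDerivAt_posPowC_comp hα ((-T) (h.accel hα))).comp (h.accel hα) (-T).hasFDerivAt
  refine (((hasFDerivAt_id (h.accel hα)).add h1).sub h2).congr_fderiv ?_
  refine ContinuousLinearMap.ext fun v => circ_ext fun x => ?_
  rw [h.linOp_coe]
  change v (x : Circ) + α * posPow (α - 1) (sol (h.accel hα) x - sol (h.accel hα) (x + Real.pi)) *
      (sol v x - sol v (x + Real.pi)) -
    α * posPow (α - 1) (-(sol (h.accel hα) x - sol (h.accel hα) (x + Real.pi))) *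
      -(sol v x - sol v (x + Real.pi)) = _
  rw [h.sol_accel hα, h.antiperiodic]
  have e1 := posPow_add_posPow_neg (p := α - 1) (by linarith) (u x - -u x)
  have e2 : |u x - -u x| ^ (α - 1) = 2 ^ α * (1 / 2) * |u x| ^ (α - 1) := by
    rw [show u x - -u x = 2 * u x by ring, abs_mul, abs_two,
      Real.mul_rpow two_pos.le (abs_nonneg _), Real.rpow_sub_one two_ne_zero]
    ring
  rw [e2] at e1
  rw [stiffness]
  linear_combination (α * (sol v x - sol v (x + Real.pi))) * e1

theorem isInvertible_of_bijective {E : Type*} [NormedAddCommGroup E] [NormedSpace ℝ E]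
    [CompleteSpace E] {A : E →L[ℝ] E} (hA : Function.Bijective A) : A.IsInvertible :=
  ⟨ContinuousLinearEquiv.ofBijective A (LinearMap.ker_eq_bot.mpr hA.1)
    (LinearMap.range_eq_top.mpr hA.2), ContinuousLinearEquiv.coe_ofBijective _ _ _⟩

theorem IsBinaryProfile.isInvertible_fderiv {α : ℝ} {u u' : ℝ → ℝ}
    (h : IsBinaryProfile α u u') (hα : 1 < α) :
    (fderiv ℝ (residual hα) (0, h.accel hα) ∘L
      ContinuousLinearMap.inr ℝ ℝ C(Circ, ℝ)).IsInvertible := by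
  have hd := ((contDiff_residual hα).differentiable one_ne_zero
    ((0 : ℝ), h.accel hα)).hasFDerivAt
  have hc := hd.comp (h.accel hα) (hasFDerivAt_prodMk_right (0 : ℝ) (h.accel hα))
  have e := hc.unique (h.hasFDerivAt_residual hα)
  rw [e]
  exact isInvertible_of_bijective ⟨h.linOp_injective hα, h.linOp_surjective hα⟩

/-! ### The symmetry in `μ` and the solution branch -/

theorem sol_neg_shift_pi (f : C(Circ, ℝ)) (x : ℝ) :
    sol (-shift Real.pi f) x = -sol f (x + Real.pi) := by
  refine (congrFun (sol_unique (w := fun x => -sol f (x + Real.pi))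
    (w' := fun x => -slope f (x + Real.pi))
    (fun x => ((hasDerivAt_sol f _).comp_add_const x Real.pi).neg) (fun x => ?_) ?_ ?_) x).symm
  · refine ((hasDerivAt_slope f _).comp_add_const x Real.pi).neg.congr_deriv ?_
    have e := periodic_circ_coe f (-(x + Real.pi))
    dsimp only at e
    rw [show -(x + Real.pi) + 2 * Real.pi = -x + Real.pi by ring] at e
    change -oddPart f (x + Real.pi) =
      (-f ((x + Real.pi : ℝ) : Circ) - -f ((-x + Real.pi : ℝ) : Circ)) / 2
    rw [e, oddPart]
    ring
  · rw [zero_add, sol_pi, neg_zero]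
  · rw [add_comm, periodic_sol f, sol_pi, neg_zero]

/-- Modulo `2π`, `π - μ` is `-(π + μ)`: reversing `μ` swaps the two neighbours, and the change of
sign of the profile swaps them back. -/
theorem residual_neg_shift {α : ℝ} (hα : 1 < α) (μ : ℝ) (f : C(Circ, ℝ)) (x : ℝ) :
    residual hα (-μ, -shift Real.pi f) (x : Circ) =
      -residual hα (μ, f) ((x + Real.pi : ℝ) : Circ) := by
  rw [residual_coe, residual_coe]
  simp only [sol_neg_shift_pi]
  have e1 : sol f (x + (Real.pi + -μ) + Real.pi) = sol f (x + Real.pi + -(Real.pi + μ)) := by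
    rw [← periodic_sol f (x + Real.pi + -(Real.pi + μ))]; congr 1; ring
  have e2 : sol f (x + Real.pi + (Real.pi + μ)) = sol f (x + -(Real.pi + -μ) + Real.pi) := by
    rw [← periodic_sol f (x + -(Real.pi + -μ) + Real.pi)]; congr 1; ring
  rw [e1, e2]
  change -f ((x + Real.pi : ℝ) : Circ) + _ - _ = _
  rw [neg_sub_neg, neg_sub_neg]
  ring

theorem residual_neg_shift_eq_zero {α : ℝ} (hα : 1 < α) {μ : ℝ} {f : C(Circ, ℝ)}
    (h : residual hα (μ, f) = 0) : residual hα (-μ, -shift Real.pi f) = 0 :=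
  circ_ext fun x => by rw [residual_neg_shift, h, ContinuousMap.zero_apply, neg_zero,
    ContinuousMap.zero_apply]

theorem IsBinaryProfile.neg_shift_accel {α : ℝ} {u u' : ℝ → ℝ} (h : IsBinaryProfile α u u')
    (hα : 1 < α) : -shift Real.pi (h.accel hα) = h.accel hα := by
  refine circ_ext fun x => ?_
  change - -force α (u (x + Real.pi)) = -force α (u x)
  rw [h.antiperiodic, force_neg, neg_neg]

/-- The branch of solutions bifurcating from the binary oscillation. -/
theorem IsBinaryProfile.exists_branch {α : ℝ} {u u' : ℝ → ℝ} (h : IsBinaryProfile α u u')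
    (hα : 1 < α) : ∃ δ > 0, ∃ L ≥ 0, ∃ f : ℝ → C(Circ, ℝ), f 0 = h.accel hα ∧
      ∀ μ ∈ Ioo (-δ) δ, ContDiffAt ℝ 1 f μ ∧ residual hα (μ, f μ) = 0 ∧
        f μ = -shift Real.pi (f (-μ)) ∧ ‖f μ‖ ≤ L ∧ ‖f μ - f 0‖ ≤ L * |μ| := by
  have cd : ContDiffAt ℝ 1 (residual hα) ((0 : ℝ), h.accel hα) :=
    (contDiff_residual hα).contDiffAt
  have hinv := h.isInvertible_fderiv hα
  set f := cd.implicitFunction one_ne_zero hinv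
  have f0 : f 0 = h.accel hα := cd.implicitFunction_apply_self one_ne_zero hinv
  have hcd : ContDiffAt ℝ 1 f 0 := cd.contDiffAt_implicitFunction one_ne_zero hinv
  have hsol := cd.eventually_apply_implicitFunction one_ne_zero hinv
  have huniq := cd.eventually_apply_eq_iff_implicitFunction one_ne_zero hinv
  rw [h.residual_accel hα] at hsol huniq
  have hneg : Tendsto (fun μ : ℝ => -μ) (𝓝 0) (𝓝 0) := by
    simpa using (continuous_neg (G := ℝ)).tendsto 0
  have hsym : ∀ᶠ μ in 𝓝 (0 : ℝ), f μ = -shift Real.pi (f (-μ)) := by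
    -- The reflected branch also tends to the binary oscillation, so it eventually lies in the
    -- neighbourhood of local uniqueness.
    have ht : Tendsto (fun μ : ℝ => (μ, -shift Real.pi (f (-μ)))) (𝓝 0)
        (𝓝 ((0 : ℝ), h.accel hα)) := by
      refine tendsto_id.prodMk_nhds ?_
      have hf : Tendsto f (𝓝 0) (𝓝 (h.accel hα)) := by
        rw [← f0]; exact hcd.continuousAt
      have := (((shift Real.pi).continuous.tendsto _).comp (hf.comp hneg)).neg
      rwa [h.neg_shift_accel hα] at this
    filter_upwards [ht.eventually huniq, hneg.eventually hsol] with μ h1 h2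
    refine h1.mp ?_
    have := residual_neg_shift_eq_zero hα h2
    rwa [neg_neg] at this
  obtain ⟨K, hK⟩ := (hcd.differentiableAt one_ne_zero).isBigO_sub.bound
  have hbd : ∀ᶠ μ in 𝓝 (0 : ℝ), ‖f μ‖ < ‖f 0‖ + 1 :=
    hcd.continuousAt.norm.eventually_lt_const (lt_add_one _)
  have hall := ((hcd.eventually (by simp)).and (hsol.and (hsym.and (hbd.and hK))))
  obtain ⟨δ, hδ, hball⟩ := Metric.eventually_nhds_iff.mp hall
  refine ⟨δ, hδ, max (‖f 0‖ + 1) K, le_max_of_le_left (by positivity), f, f0, fun μ hμ => ?_⟩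
  obtain ⟨h1, h2, h3, h4, h5⟩ := @hball μ (by
    rw [Real.dist_eq, sub_zero, abs_lt]; exact hμ)
  refine ⟨h1, h2, h3, h4.le.trans (le_max_left _ _), h5.trans ?_⟩
  rw [sub_zero, Real.norm_eq_abs]
  exact mul_le_mul_of_nonneg_right (le_max_right _ _) (abs_nonneg _)

/-! ### Travelling waves generated by a zero of the residual -/

section ResidualZero

variable {α : ℝ} {hα : 1 < α} {μ : ℝ} {f : C(Circ, ℝ)}

theorem coe_eq_of_residual_eq_zero (h : residual hα (μ, f) = 0) (x : ℝ) :
    f (x : Circ) = posPow α (sol f (x - (Real.pi + μ)) - sol f x) -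
      posPow α (sol f x - sol f (x + (Real.pi + μ))) := by
  have := residual_coe hα μ f x
  rw [h, ContinuousMap.zero_apply, ← sub_eq_add_neg] at this
  linarith

/-- The right-hand side is odd because `sol f` is, so a zero of the residual is odd and taking the
odd part in `sol` loses nothing. -/
theorem oddPart_eq_of_residual_eq_zero (h : residual hα (μ, f) = 0) (x : ℝ) :
    oddPart f x = posPow α (sol f (x - (Real.pi + μ)) - sol f x) -
      posPow α (sol f x - sol f (x + (Real.pi + μ))) := by
  rw [← coe_eq_of_residual_eq_zero h]
  refine oddPart_eq_self (fun x => ?_) x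
  rw [coe_eq_of_residual_eq_zero h, coe_eq_of_residual_eq_zero h,
    show -x - (Real.pi + μ) = -(x + (Real.pi + μ)) by ring,
    show -x + (Real.pi + μ) = -(x - (Real.pi + μ)) by ring]
  simp only [sol_neg, neg_sub_neg]
  ring

theorem isAdvanceDelaySolution_of_residual_eq_zero (h : residual hα (μ, f) = 0) :
    IsAdvanceDelaySolution α (Real.pi + μ) (sol f) := by
  refine ⟨contDiff_sol f, fun x => ?_⟩
  rw [iteratedDeriv_two_eq_of_hasDerivAt (hasDerivAt_sol f) (hasDerivAt_slope f),
    oddPart_eq_of_residual_eq_zero h, deriv_V hα, deriv_V hα, neg_sub, neg_sub]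
  ring

theorem hasDerivAt_wavePhase (α s a μ : ℝ) (n : ℤ) (t : ℝ) :
    HasDerivAt (wavePhase α s a μ n) (s * a ^ ((α - 1) / 2)) t := by
  have := ((hasDerivAt_id t).const_mul (s * a ^ ((α - 1) / 2))).const_add ((Real.pi + μ) * n)
  rwa [mul_one] at this

theorem wavePhase_add_one (α s a μ : ℝ) (n : ℤ) (t : ℝ) :
    wavePhase α s a μ (n + 1) t = wavePhase α s a μ n t + (Real.pi + μ) := by
  rw [wavePhase, wavePhase]; push_cast; ring

theorem wavePhase_sub_one (α s a μ : ℝ) (n : ℤ) (t : ℝ) :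
    wavePhase α s a μ (n - 1) t = wavePhase α s a μ n t - (Real.pi + μ) := by
  rw [wavePhase, wavePhase]; push_cast; ring

theorem hasDerivAt_travellingWave (s a : ℝ) (n : ℤ) (t : ℝ) :
    HasDerivAt (travellingWave α s a μ (sol f) n)
      (a * (slope f (wavePhase α s a μ n t) * (s * a ^ ((α - 1) / 2)))) t :=
  ((hasDerivAt_sol f _).comp t (hasDerivAt_wavePhase α s a μ n t)).const_mul a

/-- The force is homogeneous of degree `α`, and the time scaling contributes `a * a^(α-1) = a^α`;
the sign enters only as `s² = 1`. -/
theorem isChainSolution_of_residual_eq_zero (h : residual hα (μ, f) = 0) {a : ℝ} (ha : 0 < a)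
    {s : ℝ} (hs : s = 1 ∨ s = -1) :
    IsChainSolution α (travellingWave α s a μ (sol f)) := by
  intro n
  have hd' : ∀ t, HasDerivAt
      (fun t => a * (slope f (wavePhase α s a μ n t) * (s * a ^ ((α - 1) / 2))))
      (a * (oddPart f (wavePhase α s a μ n t) * (s * a ^ ((α - 1) / 2)) *
        (s * a ^ ((α - 1) / 2)))) t := fun t =>
    (((hasDerivAt_slope f _).comp t (hasDerivAt_wavePhase α s a μ n t)).mul_const _).const_mul a
  have hph : Continuous (wavePhase α s a μ n) :=
    continuous_iff_continuousAt.mpr fun t => (hasDerivAt_wavePhase α s a μ n t).continuousAt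
  refine ⟨contDiff_two_of_hasDerivAt (hasDerivAt_travellingWave s a n) hd'
    (continuous_const.mul ((((continuous_oddPart f).comp hph).mul continuous_const).mul
      continuous_const)), fun t => ?_⟩
  rw [iteratedDeriv_two_eq_of_hasDerivAt (hasDerivAt_travellingWave s a n) hd',
    deriv_V hα, deriv_V hα, neg_sub, neg_sub]
  simp only [travellingWave]
  rw [wavePhase_add_one, wavePhase_sub_one, oddPart_eq_of_residual_eq_zero h, ← mul_sub, ← mul_sub,
    posPow_mul ha.le, posPow_mul ha.le]
  have e1 : a ^ ((α - 1) / 2) * a ^ ((α - 1) / 2) * a = a ^ α := by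
    rw [← Real.rpow_add ha, ← Real.rpow_add_one ha.ne']
    congr 1; ring
  have e2 : s * s = 1 := by rcases hs with rfl | rfl <;> norm_num
  rw [← e1]
  linear_combination (a ^ ((α - 1) / 2) * a ^ ((α - 1) / 2) * a *
    (posPow α (sol f (wavePhase α s a μ n t - (Real.pi + μ)) - sol f (wavePhase α s a μ n t)) -
      posPow α (sol f (wavePhase α s a μ n t) - sol f (wavePhase α s a μ n t + (Real.pi + μ))))) * e2

/-- A function with vanishing derivative on a symmetric interval is constant there. -/
theorem eq_of_hasDerivAt_zero_on {g g' : ℝ → ℝ} (hg : ∀ x, HasDerivAt g (g' x) x) {r : ℝ}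
    (h0 : ∀ x ∈ Icc (-r) r, g' x = 0) {x : ℝ} (hx : x ∈ Icc (-r) r) : g x = g 0 := by
  have hr : (0 : ℝ) ∈ Icc (-r) r := ⟨by linarith [hx.1, hx.2], by linarith [hx.1, hx.2]⟩
  have := (convex_Icc (-r) r).norm_image_sub_le_of_norm_hasDerivWithin_le (f := g) (f' := g')
    (C := 0) (fun y _ => (hg y).hasDerivWithinAt) (fun y hy => by rw [h0 y hy, norm_zero]) hr hx
  rw [zero_mul, norm_le_zero_iff, sub_eq_zero] at this
  exact this

variable {r : ℝ}

/-- Oddness of the profile turns the open contact ahead at `-x` into an open contact behind at `x`.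
-/
theorem sol_sub_lt (hr : ∀ x ∈ Icc (-r) r, sol f x < sol f (x + (Real.pi + μ))) {x : ℝ}
    (hx : x ∈ Icc (-r) r) : sol f (x - (Real.pi + μ)) < sol f x := by
  have := hr (-x) ⟨by linarith [hx.2], by linarith [hx.1]⟩
  rw [show -x + (Real.pi + μ) = -(x - (Real.pi + μ)) by ring, sol_neg, sol_neg] at this
  linarith

/-- With both contacts open both truncated powers vanish, so the acceleration is zero. -/
theorem slope_eq_of_gap (h : residual hα (μ, f) = 0)
    (hr : ∀ x ∈ Icc (-r) r, sol f x < sol f (x + (Real.pi + μ))) {x : ℝ}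
    (hx : x ∈ Icc (-r) r) : slope f x = slope f 0 := by
  refine eq_of_hasDerivAt_zero_on (hasDerivAt_slope f) (fun y hy => ?_) hx
  have h1 := hr y hy
  have h2 := sol_sub_lt hr hy
  rw [oddPart_eq_of_residual_eq_zero h, posPow_of_nonpos (by linarith) (by linarith),
    posPow_of_nonpos (by linarith) (by linarith), sub_zero]

theorem sol_eq_of_gap (h : residual hα (μ, f) = 0)
    (hr : ∀ x ∈ Icc (-r) r, sol f x < sol f (x + (Real.pi + μ))) {x : ℝ}
    (hx : x ∈ Icc (-r) r) : sol f x = slope f 0 * x := by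
  have := eq_of_hasDerivAt_zero_on (g := fun x => sol f x - slope f 0 * x)
    (g' := fun x => slope f x - slope f 0) (fun x => by
      have := (hasDerivAt_sol f x).sub ((hasDerivAt_id x).const_mul (slope f 0))
      rwa [mul_one] at this)
    (fun y hy => by rw [slope_eq_of_gap h hr hy, sub_self]) hx
  rw [sol_zero, mul_zero, sub_zero] at this
  linarith

theorem free_flight_of_gap (h : residual hα (μ, f) = 0)
    (hr : ∀ x ∈ Icc (-r) r, sol f x < sol f (x + (Real.pi + μ))) {a : ℝ} (ha : 0 < a) (s : ℝ)
    (n k : ℤ) (t : ℝ) (hmem : wavePhase α s a μ n t ∈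
      Ioo (-r + 2 * k * Real.pi) (r + 2 * k * Real.pi)) :
    travellingWave α s a μ (sol f) (n + 1) t > travellingWave α s a μ (sol f) n t ∧
    travellingWave α s a μ (sol f) n t > travellingWave α s a μ (sol f) (n - 1) t ∧
    HasDerivAt (travellingWave α s a μ (sol f) n)
      (s * a ^ ((α + 1) / 2) * slope f 0) t := by
  set x := wavePhase α s a μ n t - k * (2 * Real.pi) with hx
  have hphase : wavePhase α s a μ n t = x + k * (2 * Real.pi) := by rw [hx]; ring
  have hxm : x ∈ Icc (-r) r := ⟨by linarith [hmem.1], by linarith [hmem.2]⟩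
  have hper : ∀ y, sol f (y + k * (2 * Real.pi)) = sol f y := fun y => (periodic_sol f).int_mul k y
  have hslope : slope f (x + k * (2 * Real.pi)) = slope f x := (periodic_slope f).int_mul k x
  refine ⟨?_, ?_, ?_⟩
  · simp only [travellingWave, wavePhase_add_one, hphase]
    rw [add_right_comm, hper, hper]
    exact mul_lt_mul_of_pos_left (hr x hxm) ha
  · simp only [travellingWave, wavePhase_sub_one, hphase]
    rw [add_sub_right_comm, hper, hper]
    exact mul_lt_mul_of_pos_left (sol_sub_lt hr hxm) ha
  · refine (hasDerivAt_travellingWave s a n t).congr_deriv ?_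
    rw [hphase, hslope, slope_eq_of_gap h hr hxm,
      show (α + 1) / 2 = (α - 1) / 2 + 1 by ring, Real.rpow_add_one ha.ne']
    ring

end ResidualZero

/-- Near the origin, the profile is close to its linearization at `μ = 0`. -/
theorem abs_sol_sub_linear_le {f f₀ : C(Circ, ℝ)} {L μ ξ : ℝ} (hL : 0 ≤ L) (hf : ‖f‖ ≤ L)
    (hd : ‖f - f₀‖ ≤ L * |μ|) (hξ : |ξ| ≤ 2 * |μ|) :
    |sol f ξ - slope f₀ 0 * ξ| ≤ (4 + 8 * Real.pi) * L * μ ^ 2 := by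
  have hpi := Real.pi_pos
  have h1 := abs_taylor_two_le (hasDerivAt_sol f) (hasDerivAt_slope f) (abs_oddPart_le f) 0 ξ
  rw [zero_add, sol_zero, sub_zero] at h1
  have h2 : |slope f 0 - slope f₀ 0| ≤ 4 * Real.pi * (L * |μ|) := by
    have := abs_slope_le (f - f₀) 0
    rw [show slope (f - f₀) 0 = slope f 0 - slope f₀ 0 by
      rw [sub_eq_add_neg, ← neg_one_smul ℝ f₀, slope_add, slope_smul]; ring] at this
    exact this.trans (by gcongr)
  have h3 : ‖f‖ * |ξ| * |ξ| ≤ L * (2 * |μ|) * (2 * |μ|) := by gcongr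
  have h4 : |ξ * (slope f 0 - slope f₀ 0)| ≤ 2 * |μ| * (4 * Real.pi * (L * |μ|)) := by
    rw [abs_mul]; gcongr
  have e : sol f ξ - slope f₀ 0 * ξ =
      (sol f ξ - ξ * slope f 0) + ξ * (slope f 0 - slope f₀ 0) := by ring
  rw [e]
  refine (abs_add_le _ _).trans ((add_le_add (h1.trans h3) h4).trans (le_of_eq ?_))
  rw [← sq_abs μ]
  ring

/-- For `μ < 0`, consecutive beads lose contact on a time interval of length close to `|μ|`. -/
theorem gap_of_branch {f : ℝ → C(Circ, ℝ)} {L μ p : ℝ} (hL : 0 ≤ L) (hp : 0 < p)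
    (hp0 : slope (f 0) 0 = p) (hμ : μ < 0) (hsym : f μ = -shift Real.pi (f (-μ)))
    (hf : ‖f μ‖ ≤ L) (hf' : ‖f (-μ)‖ ≤ L) (hd : ‖f μ - f 0‖ ≤ L * |μ|)
    (hd' : ‖f (-μ) - f 0‖ ≤ L * |μ|) {ξ : ℝ}
    (hξ : ξ ∈ Icc (-(|μ| / 2 - ((4 + 8 * Real.pi) * L + 1) / p * μ ^ 2))
      (|μ| / 2 - ((4 + 8 * Real.pi) * L + 1) / p * μ ^ 2)) :
    sol (f μ) ξ < sol (f μ) (ξ + (Real.pi + μ)) := by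
  have hpi := Real.pi_pos
  set K := (4 + 8 * Real.pi) * L
  have hK : 0 ≤ K := by positivity
  -- The errors in `h1` and `h2` cost `2 * K * μ²`; shortening the half-length by `A * μ²` gains `2
  -- * p * A * μ² = 2 * (K + 1) * μ²`, leaving a margin `2 * μ²`.
  set A := (K + 1) / p with hA
  have hAp : A * p = K + 1 := div_mul_cancel₀ _ hp.ne'
  have hA0 : 0 ≤ A * μ ^ 2 := by positivity
  have habs : |μ| = -μ := abs_of_neg hμ
  have hμ2 : 0 < μ ^ 2 := sq_pos_of_neg hμ
  rw [habs] at hξ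
  have hξ1 : |ξ| ≤ 2 * |μ| := by
    rw [habs, abs_le]; constructor <;> linarith [hξ.1, hξ.2]
  have hξ2 : |ξ + μ| ≤ 2 * |-μ| := by
    rw [abs_neg, habs, abs_le]; constructor <;> linarith [hξ.1, hξ.2]
  have h1 := abs_le.mp (abs_sol_sub_linear_le hL hf hd hξ1)
  have h2 := abs_le.mp (abs_sol_sub_linear_le hL hf' (by rwa [abs_neg]) hξ2)
  rw [hp0] at h1 h2
  rw [neg_sq] at h2
  have e : sol (f μ) (ξ + (Real.pi + μ)) = -sol (f (-μ)) (ξ + μ) := by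
    rw [hsym, sol_neg_shift_pi, ← periodic_sol _ (ξ + μ)]
    congr 2; ring
  rw [e]
  have h3 : p * ξ ≤ p * (-μ / 2 - A * μ ^ 2) := mul_le_mul_of_nonneg_left hξ.2 hp.le
  have h4 : A * p * μ ^ 2 = (K + 1) * μ ^ 2 := by rw [hAp]
  linarith [h1.1, h1.2, h2.1, h2.2]

end HertzChain

end

/-! ### Assembly of the main theorem -/

theorem theorem1 (α : ℝ) (hα : 1 < α) :
    ∃ δ : ℝ, 0 < δ ∧ ∃ u : ℝ → HertzChain.CPer 2,
      -- `μ ↦ u_μ` is of class `C¹` from `𝒱 = (-δ, δ)` to `C²_per(0, 2π)`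
      ContDiffOn ℝ 1 u (Ioo (-δ) δ) ∧
      -- the profiles are odd, solve the advance-delay equation, and have the symmetry in `μ`
      (∀ μ ∈ Ioo (-δ) δ,
        (∀ ξ : ℝ, u μ (-ξ) = -u μ ξ) ∧
        HertzChain.IsAdvanceDelaySolution α (Real.pi + μ) (u μ) ∧
        ∀ ξ : ℝ, u μ ξ = -u (-μ) (ξ + Real.pi)) ∧
      -- they generate the two-parameter families of travelling waves `x_n^±(t; a, μ)`
      (∀ μ ∈ Ioo (-δ) δ, ∀ a : ℝ, 0 < a → ∀ s : ℝ, (s = 1 ∨ s = -1) →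
        HertzChain.IsChainSolution α (HertzChain.travellingWave α s a μ (u μ))) ∧
      -- `u_0` is the solution of the initial value problem of the binary oscillation
      (∀ v : ℝ → ℝ, HertzChain.IsBinaryOscillation α v ↔ v = u 0) ∧
      -- for `μ < 0`: linear part of the profile and free flight
      ∃ ξ₁ p : ℝ → ℝ,
        (fun μ => ξ₁ μ - |μ| / 2) =o[𝓝[<] 0] (fun μ : ℝ => μ) ∧
        (fun μ => p μ - HertzChain.p₀ α) =O[𝓝[<] 0] (fun μ : ℝ => |μ|) ∧
        ∀ μ ∈ Ioo (-δ) 0,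
          0 < ξ₁ μ ∧
          (∀ ξ ∈ Icc (-ξ₁ μ) (ξ₁ μ), u μ ξ = p μ * ξ) ∧
          ∀ a : ℝ, 0 < a → ∀ s : ℝ, (s = 1 ∨ s = -1) → ∀ (n k : ℤ) (t : ℝ),
            HertzChain.wavePhase α s a μ n t ∈
              Ioo (-ξ₁ μ + 2 * k * Real.pi) (ξ₁ μ + 2 * k * Real.pi) →
            HertzChain.travellingWave α s a μ (u μ) (n + 1) t >
              HertzChain.travellingWave α s a μ (u μ) n t ∧
            HertzChain.travellingWave α s a μ (u μ) n t >
              HertzChain.travellingWave α s a μ (u μ) (n - 1) t ∧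
            HasDerivAt (HertzChain.travellingWave α s a μ (u μ) n)
              (s * a ^ ((α + 1) / 2) * p μ) t := by
  open HertzChain in
  obtain ⟨v, v', hv⟩ := exists_isBinaryProfile hα
  obtain ⟨δ₀, hδ₀, L, hL, f, f0, hf⟩ := hv.exists_branch hα
  have hpi := Real.pi_pos
  have hp := p₀_pos hα
  have hsol0 : sol (f 0) = v := by rw [f0, hv.sol_accel hα]
  have hslope0 : slope (f 0) 0 = p₀ α := by
    have h1 := hasDerivAt_sol (f 0) 0
    rw [hsol0] at h1
    rw [← hv.deriv_zero]
    exact h1.unique (hv.hasDerivAt 0)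
  set A := ((4 + 8 * Real.pi) * L + 1) / p₀ α
  have hA : 0 < A := by positivity
  -- The bound `1 / (2 * A)` is what makes `ξ₁ μ = |μ| / 2 - A * μ ^ 2` positive for `-δ < μ < 0`.
  set δ := min δ₀ (1 / (2 * A))
  have hδ : 0 < δ := lt_min hδ₀ (by positivity)
  have hsub : Ioo (-δ) δ ⊆ Ioo (-δ₀) δ₀ :=
    Ioo_subset_Ioo (neg_le_neg (min_le_left _ _)) (min_le_left _ _)
  have hneg : ∀ μ ∈ Ioo (-δ) δ, -μ ∈ Ioo (-δ) δ := fun μ hμ =>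
    ⟨by linarith [hμ.2], by linarith [hμ.1]⟩
  have hres : ∀ μ ∈ Ioo (-δ) δ, residual hα (μ, f μ) = 0 := fun μ hμ => (hf μ (hsub hμ)).2.1
  refine ⟨δ, hδ, fun μ => solCPer (f μ), fun μ hμ => ?_, fun μ hμ => ⟨sol_neg (f μ),
    isAdvanceDelaySolution_of_residual_eq_zero (hres μ hμ), fun ξ => ?_⟩, fun μ hμ a ha s hs =>
    isChainSolution_of_residual_eq_zero (hres μ hμ) ha hs, fun w => ?_,
    fun μ => |μ| / 2 - A * μ ^ 2, fun μ => slope (f μ) 0, ?_, ?_, fun μ hμ => ?_⟩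
  · exact (solCPer.contDiff.contDiffAt.comp μ (hf μ (hsub hμ)).1).contDiffWithinAt
  · change sol (f μ) ξ = -sol (f (-μ)) (ξ + Real.pi)
    rw [(hf μ (hsub hμ)).2.2.1, sol_neg_shift_pi]
  · change _ ↔ w = sol (f 0)
    rw [hsol0]
    exact hv.isBinaryOscillation_iff hα w
  · have h : (fun μ : ℝ => |μ| / 2 - A * μ ^ 2 - |μ| / 2) = fun μ => -A * μ ^ 2 :=
      funext fun μ => by ring
    rw [h]
    exact ((isLittleO_pow_id (by norm_num)).const_mul_left _).mono nhdsWithin_le_nhds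
  · refine IsBigO.of_bound (4 * Real.pi * L) ?_
    filter_upwards [mem_nhdsWithin_of_mem_nhds (Ioo_mem_nhds (neg_lt_zero.mpr hδ) hδ)] with μ hμ
    rw [← hslope0, Real.norm_eq_abs, Real.norm_eq_abs, abs_abs]
    have h1 := abs_slope_le (f μ - f 0) 0
    rw [show slope (f μ - f 0) 0 = slope (f μ) 0 - slope (f 0) 0 by
      rw [sub_eq_add_neg, ← neg_one_smul ℝ (f 0), slope_add, slope_smul]; ring] at h1
    have h2 := (hf μ (hsub hμ)).2.2.2.2
    calc _ ≤ 4 * Real.pi * ‖f μ - f 0‖ := h1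
      _ ≤ 4 * Real.pi * (L * |μ|) := by gcongr
      _ = _ := by ring
  · have hμ' : μ ∈ Ioo (-δ) δ := ⟨hμ.1, hμ.2.trans hδ⟩
    have habs : |μ| = -μ := abs_of_neg hμ.2
    obtain ⟨-, h2, h3, h4, h5⟩ := hf μ (hsub hμ')
    obtain ⟨-, -, -, h4', h5'⟩ := hf (-μ) (hsub (hneg μ hμ'))
    rw [abs_neg] at h5'
    have hgap := fun ξ hξ => gap_of_branch (ξ := ξ) hL hp hslope0 hμ.2 h3 h4 h4' h5 h5' hξ
    refine ⟨?_, fun ξ hξ => sol_eq_of_gap h2 hgap hξ, fun a ha s _ n k t hmem =>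
      free_flight_of_gap h2 hgap ha s n k t hmem⟩
    have h6 : -μ < 1 / (2 * A) := by linarith [hμ.1, min_le_right δ₀ (1 / (2 * A))]
    rw [lt_div_iff₀ (by positivity)] at h6
    change 0 < |μ| / 2 - A * μ ^ 2
    rw [habs]
    nlinarith [mul_pos (neg_pos.mpr hμ.2) (show 0 < 1 - -μ * (2 * A) by linarith)]
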